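/- **Setting.** Memoized Quicksort works on boxed integer lists. A boxed list is a box, carrying a unique integer tag, that contains either NIL or CONS$(h,t)$ with $h\in\mathbb Z$ and $t$ a boxed list. The program has the following functions. * `hCons(h,t)`, memoized on $h$ and the tag of $t$: returns a new box of CONS$(h,t)$. * `mfil(g,l)`: if $l$ is NIL, returns the fixed box `empty` of NIL; if $l$ is CONS$(h,t)$, computes $tt=$ `mfil(g,t)` and returns `hCons(h,tt)` if $g(h)$ holds, and $tt$ otherwise. * `mqs(l)`, memoized on the tag of $l$: returns the empty list if $l$ is NIL; if $l$ is CONS$(h,t)$, computes $s=$ `mfil(x<h, t)` and $g=$ `mfil(x>=h, t)` and returns `(mqs s)@(h::(mqs g))`. The time is the number of elementary steps: a constant for each call, unboxing, comparison, box allocation and creation of a hash table, $|u|+O(1)$ for appending to a list $u$, plus the steps of the memo-table operations. The memo tables are (for `hCons`, nested) hash tables with chaining. The number of buckets is a power of two, is never smaller than the number of entries, and is doubled when the table is full; the entries are copied to the larger bucket array incrementally, one older entry per insertion, so that an insertion takes $O(1)$ steps. A lookup takes one step plus one step for each chain cell that it examines. For every table and every number $m=2^j$ of buckets there is a random hash function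 $h$ from $\mathbb Z$ to the $m$ buckets, and the hash functions are *$c$-universal*: $\Pr[h(x)=h(y)]\le c/m$ for all integers $x\ne y$. (No independence between the hash functions is assumed.) **Theorem.** For every $c\ge 0$ there is a constant $C$, depending only on $c$, such that the following holds for all $c$-universal random hash functions. Let $L$ be a finite list of integers and $a$ an integer such that the keys of $L'=[a,L]$ are pairwise distinct, and let $n$ be the length of $L'$. Replace $L$ by a uniformly random permutation of itself, chosen independently of the hash functions. Starting with empty memo tables, run memoized Quicksort on $L$ and then, keeping the memo tables, on $L'=[a,L]$, where $L'$ is obtained by adding $a$ at the front of the boxed list $L$. Then the expected number of steps of the second run, over the random permutation and the hash functions, is at most $C\,n$. This holds both if the caller builds the input lists by allocating new boxes and if the caller builds them with `hCons`. -/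

import Mathlib

open MeasureTheory
open scoped ENNReal NNReal

namespace MemoQuicksort

/-! ### Boxed integer lists

A box carries a unique tag (its location), which is the integer used to index memo tables.
The program below inspects a boxed list only by reading its tag and by unboxing it. -/

inductive BList : Type
  | nil (tag : ℕ) : BList
  | cons (tag : ℕ) (head : ℤ) (tail : BList) : BList

def BList.tag : BList → ℕ
  | .nil t => t
  | .cons t _ _ => t

/-! ### Hash tables with chaining

A hash function supplies, for every level `j`, a map from integer keys to `2 ^ j` buckets. -/

abbrev HashFn : Type := (j : ℕ) → ℤ → Fin (2 ^ j)

/-- A hash table with chaining that always holds at most as many entries as buckets.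
It has `2 ^ level` buckets.  So that no single operation pays for a global rehash, the bucket
array of the next level is filled gradually: every insertion also copies one of the `pending`
older entries to `nextBuckets`.  When the table is full, `nextBuckets` holds all the entries and
replaces `buckets`. -/
structure HashTable (α : Type) : Type where
  level : ℕ
  count : ℕ
  buckets : ℕ → List (ℤ × α)
  nextBuckets : ℕ → List (ℤ × α)
  entries : List (ℤ × α)
  pending : List (ℤ × α)

namespace HashTable

variable {α : Type}

def empty : HashTable α where
  level := 0
  count := 0
  buckets := fun _ => []
  nextBuckets := fun _ => []
  entries := []
  pending := []

/-- Walk along a chain; returns the value found, if any, and the number of cells examined. -/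
def scan (k : ℤ) : List (ℤ × α) → Option α × ℕ
  | [] => (none, 0)
  | e :: rest =>
    if e.1 = k then (some e.2, 1)
    else ((scan k rest).1, (scan k rest).2 + 1)

/-- Look up a key; returns the value found, if any, and the number of steps:
one for the hash function and one for every cell examined. -/
def lookup (h : HashFn) (T : HashTable α) (k : ℤ) : Option α × ℕ :=
  ((scan k (T.buckets (h T.level k))).1, (scan k (T.buckets (h T.level k))).2 + 1)

/-- Put an entry at the front of bucket `i`. -/
def push (b : ℕ → List (ℤ × α)) (i : ℕ) (e : ℤ × α) : ℕ → List (ℤ × α) :=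
  Function.update b i (e :: b i)

/-- Copy the first pending entry, if any, into the bucket array of level `j`. -/
def copyOne (h : HashFn) (j : ℕ) (b : ℕ → List (ℤ × α)) :
    List (ℤ × α) → ℕ → List (ℤ × α)
  | [] => b
  | e :: _ => push b (h j e.1) e

/-- Insert a key that is not in the table. -/
def insert (h : HashFn) (T : HashTable α) (k : ℤ) (v : α) : HashTable α :=
  let cur := push T.buckets (h T.level k) (k, v)
  let nxt := copyOne h (T.level + 1)
    (push T.nextBuckets (h (T.level + 1) k) (k, v)) T.pending
  if T.count + 1 = 2 ^ T.level then
    { level := T.level + 1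
      count := T.count + 1
      buckets := nxt
      nextBuckets := fun _ => []
      entries := (k, v) :: T.entries
      pending := (k, v) :: T.entries }
  else
    { level := T.level
      count := T.count + 1
      buckets := cur
      nextBuckets := nxt
      entries := (k, v) :: T.entries
      pending := T.pending.tail }

/-- Steps for an insertion: at most three entries are pushed, eight cells of a later bucket
array are initialized (which suffices to have every array ready when it is needed), and one
step goes to bookkeeping. -/
def insertCost : ℕ := 12

/-- Steps for the creation of an empty table, with its bucket arrays of sizes 1 and 2. -/
def newCost : ℕ := 4

end HashTable

/-! ### The store -/

/-- The hash tables in use: the memo table of Quicksort, the outer table of the nested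
memo table of hash-consing (keyed by heads), and its inner tables (keyed by tags of tails). -/
inductive TableId : Type
  | results : TableId
  | heads : TableId
  | tails (loc : ℕ) : TableId

/-- Every table has a hash function of its own. -/
abbrev Hashes : Type := TableId → HashFn

/-- The state of a computation.  The field `heads` maps a head to the location of the inner
table for that head; `clock` counts the steps. -/
structure Store : Type where
  clock : ℕ
  nextTag : ℕ
  results : HashTable (List ℤ)
  heads : HashTable ℕ
  nextLoc : ℕ
  tails : ℕ → HashTable BList

def Store.tick (σ : Store) (k : ℕ) : Store := { σ with clock := σ.clock + k }

/-- The box `empty = box NIL` that belongs to the program. -/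
def emptyBox : BList := .nil 0

/-- All memo tables are empty; the only box allocated is `emptyBox`. -/
def Store.initial : Store where
  clock := 0
  nextTag := 1
  results := HashTable.empty
  heads := HashTable.empty
  nextLoc := 0
  tails := fun _ => HashTable.empty

/-! ### The program

Each function takes the store and returns its result with the new store. -/

/-- `box NIL` -/
def boxNil (σ : Store) : BList × Store :=
  (.nil σ.nextTag, { σ.tick 1 with nextTag := σ.nextTag + 1 })

/-- `box (CONS (x, t))` -/
def boxCons (x : ℤ) (t : BList) (σ : Store) : BList × Store :=
  (.cons σ.nextTag x t, { σ.tick 1 with nextTag := σ.nextTag + 1 })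

/-- First stage of the nested lookup: the location of the inner table for the head `x`,
which is created if there is none. -/
def innerTable (H : Hashes) (x : ℤ) (σ : Store) : ℕ × Store :=
  let r := σ.heads.lookup (H .heads) x
  let σ₁ := σ.tick r.2
  match r.1 with
  | some loc => (loc, σ₁)
  | none =>
    (σ₁.nextLoc,
      { σ₁.tick (HashTable.newCost + HashTable.insertCost) with
        heads := σ₁.heads.insert (H .heads) x σ₁.nextLoc
        tails := Function.update σ₁.tails σ₁.nextLoc HashTable.empty
        nextLoc := σ₁.nextLoc + 1 })

/-- Hash-consing: `box (CONS (x, t))`, memoized on `x` and the tag of `t`. -/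
def hCons (H : Hashes) (x : ℤ) (t : BList) (σ : Store) : BList × Store :=
  let p := innerTable H x (σ.tick 1)
  let loc := p.1
  let σ₁ := p.2
  let r := (σ₁.tails loc).lookup (H (.tails loc)) t.tag
  let σ₂ := σ₁.tick r.2
  match r.1 with
  | some b => (b, σ₂)
  | none =>
    let q := boxCons x t σ₂
    let σ₃ := q.2
    (q.1,
      { σ₃.tick HashTable.insertCost with
        tails := Function.update σ₃.tails loc
          ((σ₃.tails loc).insert (H (.tails loc)) t.tag q.1) })

/-- The filter, which returns a hash-consed list.  One step per call and one per test. -/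
def mfil (H : Hashes) (g : ℤ → Bool) : BList → Store → BList × Store
  | .nil _, σ => (emptyBox, σ.tick 1)
  | .cons _ x t, σ =>
    let p := mfil H g t (σ.tick 1)
    if g x then hCons H x p.1 (p.2.tick 1) else (p.1, p.2.tick 1)

/-- Enter the result `v` for the argument `l` into the memo table of Quicksort. -/
def memoize (H : Hashes) (l : BList) (v : List ℤ) (σ : Store) : Store :=
  { σ.tick HashTable.insertCost with
    results := σ.results.insert (H .results) l.tag v }

/-- The store after a call of Quicksort on `l` has consulted its memo table: one step for the
call and the steps of the lookup. -/
def consult (H : Hashes) (l : BList) (σ : Store) : Store :=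
  σ.tick (1 + (σ.results.lookup (H .results) l.tag).2)

/-- The result stored for `l` in the memo table of Quicksort, if any. -/
def stored (H : Hashes) (l : BList) (σ : Store) : Option (List ℤ) :=
  (σ.results.lookup (H .results) l.tag).1

/-- The keys less than the pivot. -/
def lesser (H : Hashes) (x : ℤ) (l : BList) (σ : Store) : BList × Store :=
  mfil H (fun y => decide (y < x)) l σ

/-- The keys greater than or equal to the pivot. -/
def greater (H : Hashes) (x : ℤ) (l : BList) (σ : Store) : BList × Store :=
  mfil H (fun y => decide (y ≥ x)) l σ

/-- Big-step semantics of memoized Quicksort, with the first key as pivot: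
`Mqs H l σ v σ'` says that the call on `l` in the store `σ` returns `v` and leaves the store `σ'`.
If the result is not found, unboxing `l` costs one step, and appending the result `ss` for the
lesser keys to `x :: gg` costs one step for each key of `ss` and two more. -/
inductive Mqs (H : Hashes) : BList → Store → List ℤ → Store → Prop
  | found {l : BList} {σ : Store} {v : List ℤ} :
      stored H l σ = some v → Mqs H l σ v (consult H l σ)
  | nil {t : ℕ} {σ : Store} :
      stored H (.nil t) σ = none →
      Mqs H (.nil t) σ [] (memoize H (.nil t) [] ((consult H (.nil t) σ).tick 1))
  | cons {t : ℕ} {x : ℤ} {rest s g : BList} {σ σ₁ σ₂ σ₃ σ₄ : Store} {ss gg : List ℤ} :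
      stored H (.cons t x rest) σ = none →
      lesser H x rest ((consult H (.cons t x rest) σ).tick 1) = (s, σ₁) →
      greater H x rest σ₁ = (g, σ₂) →
      Mqs H s σ₂ ss σ₃ →
      Mqs H g σ₃ gg σ₄ →
      Mqs H (.cons t x rest) σ (ss ++ x :: gg)
        (memoize H (.cons t x rest) (ss ++ x :: gg) (σ₄.tick (ss.length + 2)))

/-- A call has at most one outcome. -/
theorem Mqs.unique {H : Hashes} {l : BList} {σ : Store} {v w : List ℤ} {τ τ' : Store}
    (h : Mqs H l σ v τ) (k : Mqs H l σ w τ') : v = w ∧ τ = τ' := by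
  induction h generalizing w τ' with
  | found h =>
    cases k <;> simp_all
  | nil h =>
    cases k <;> simp_all
  | cons h hs hg _ _ ihs ihg =>
    cases k with
    | found k => simp_all
    | cons k ks kg k1 k2 =>
      obtain ⟨rfl, rfl⟩ := Prod.mk.inj (hs.symm.trans ks)
      obtain ⟨rfl, rfl⟩ := Prod.mk.inj (hg.symm.trans kg)
      obtain ⟨rfl, rfl⟩ := ihs k1
      obtain ⟨rfl, rfl⟩ := ihg k2
      exact ⟨rfl, rfl⟩

/-! ### The experiment -/

/-- How the caller of Quicksort extends an input list by a key: with the hash-consing function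
of the program if `shared`, and otherwise by allocating a new box. -/
def inputCons (H : Hashes) (shared : Bool) (x : ℤ) (t : BList) (σ : Store) : BList × Store :=
  if shared then hCons H x t σ else boxCons x t σ

/-- The boxed input list with the given keys. -/
def inputList (H : Hashes) (shared : Bool) : List ℤ → Store → BList × Store
  | [], σ => if shared then (emptyBox, σ) else boxNil σ
  | x :: L, σ =>
    let p := inputList H shared L σ
    inputCons H shared x p.1 p.2

/-- Starting with empty memo tables, memoized Quicksort is run on `L` and then on `a :: L`,
whose box is made by adding `a` to the boxed list `L`; the second run takes `m` steps. -/
def SecondRun (H : Hashes) (shared : Bool) (a : ℤ) (L : List ℤ) (m : ℕ) : Prop :=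
  ∃ (l l' : BList) (σ₀ σ₁ σ₂ σ₃ : Store) (v w : List ℤ),
    inputList H shared L Store.initial = (l, σ₀) ∧
    Mqs H l σ₀ v σ₁ ∧
    inputCons H shared a l σ₁ = (l', σ₂) ∧
    Mqs H l' { σ₂ with clock := 0 } w σ₃ ∧
    m = σ₃.clock

/-- The number of steps is determined. -/
theorem SecondRun.unique {H : Hashes} {shared : Bool} {a : ℤ} {L : List ℤ} {m m' : ℕ}
    (h : SecondRun H shared a L m) (k : SecondRun H shared a L m') : m = m' := by
  obtain ⟨l, l', σ₀, σ₁, σ₂, σ₃, v, w, h1, h2, h3, h4, rfl⟩ := h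
  obtain ⟨_, _, _, _, _, _, _, _, k1, k2, k3, k4, rfl⟩ := k
  obtain ⟨rfl, rfl⟩ := Prod.mk.inj (h1.symm.trans k1)
  obtain ⟨rfl, rfl⟩ := h2.unique k2
  obtain ⟨rfl, rfl⟩ := Prod.mk.inj (h3.symm.trans k3)
  obtain ⟨rfl, rfl⟩ := h4.unique k4
  rfl

/-- The number of steps of the second run; infinite if one of the two runs diverges. -/
noncomputable def secondRunTime (H : Hashes) (shared : Bool) (a : ℤ) (L : List ℤ) : ℝ≥0∞ :=
  ⨅ (m : ℕ) (_ : SecondRun H shared a L m), (m : ℝ≥0∞)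

/-- The hash functions, drawn at random, are `c`-universal: for every table and every number
of buckets, two different keys collide with probability at most `c` over the number of buckets.
No independence between different tables, levels or keys is required. -/
structure IsUniversal {Ω : Type*} [MeasurableSpace Ω] (P : Measure Ω) (c : ℝ≥0)
    (H : Ω → Hashes) : Prop where
  measurable : ∀ (i : TableId) (j : ℕ) (x : ℤ), Measurable fun ω => H ω i j x
  collision : ∀ (i : TableId) (j : ℕ) (x y : ℤ), x ≠ y →
    P {ω | H ω i j x = H ω i j y} ≤ (c : ℝ≥0∞) / 2 ^ j

/-- The list `L` with its positions permuted by `π`. -/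
def permuted (L : List ℤ) (π : Equiv.Perm (Fin L.length)) : List ℤ :=
  List.ofFn fun i => L.get (π i)

/-- The expected number of steps of the second run, over a uniformly random permutation of `L`
and, independently, over the random choice of the hash functions. -/
noncomputable def expectedTime {Ω : Type*} [MeasurableSpace Ω] (P : Measure Ω)
    (H : Ω → Hashes) (shared : Bool) (a : ℤ) (L : List ℤ) : ℝ≥0∞ :=
  (∑ π : Equiv.Perm (Fin L.length), ∫⁻ ω, secondRunTime (H ω) shared a (permuted L π) ∂P)
    / (L.length.factorial : ℝ≥0∞)

end MemoQuicksort

/-!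
The hash functions influence the cost of a run but not what it computes: a lookup returns what the
table associates with the key, in whichever bucket that entry lies, and tags and table locations
are handed out in the order of the calls.  So `Runs` describes a computation by the contents of the
tables alone, together with a list of probes that is the same for all hash functions.  Besides
constant costs, a probe pays for the keys in the table that collide with its key.  As a table has
at least as many buckets as entries, `c`-universality bounds the expectation of this by `c`
(`IsUniversal.lintegral_probe_le`), and it remains to bound the number of steps and probes of the
second run for a random order of the keys.

The first run stores the result for every list that occurs in its recursion; apart from the input
itself, these lists are hash-consed, so that equal lists have equal boxes (`Contents.Canon.unique`).
The second run splits `L` at `a`.  On the part less than `a`, the recursion follows the search path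
of `a` in the tree of the first run.  Let `K` be the list of a node of this path and `x` its pivot.
If `x < a`, the keys of `K` less than `x` form a list of the first run, whose result is found at
once, and the keys of `K` between `x` and `a` are the part less than `a` of the next node.
If `x > a`, the part of `K` less than `a` is already that of the next node.  The part greater than
`a` is symmetric.  Hence the cost is linear in the sum of the sizes of the nodes on the search path
(`Contents.exists_runs_mqs_lt`, `Contents.exists_runs_mqs_ge`, `exists_secondRunTime_le`).

For a random order, the pivot of a node with `m` keys is uniformly distributed among them, and the
next node on the path has at most `3 m / 4` keys on average (`four_mul_sum_card_sameSide`).  The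
sizes therefore add up to at most `4 m + 1` on average (`sum_pathSize_le`).
-/

namespace MemoQuicksort

/-! ### Hash tables -/

/-- In a list without repeated keys, association is membership. -/
theorem lookup_eq_some_iff_mem {α : Type} {k : ℤ} {v : α} :
    ∀ {l : List (ℤ × α)}, (l.map Prod.fst).Nodup → (l.lookup k = some v ↔ (k, v) ∈ l)
  | [], _ => by simp
  | (y, w) :: l, hl => by
    simp only [List.map_cons, List.nodup_cons] at hl
    have ih := lookup_eq_some_iff_mem (k := k) (v := v) hl.2
    by_cases hk : k = y
    · subst hk
      have hv : (k, v) ∉ l := fun h => hl.1 (List.mem_map_of_mem (f := Prod.fst) h)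
      simp [hv, eq_comm]
    · have hb : (k == y) = false := by simpa using hk
      simp [List.lookup_cons, hb, ih, hk]

theorem lookup_cons_self {α : Type} (k : ℤ) (v : α) (l : List (ℤ × α)) :
    ((k, v) :: l).lookup k = some v := by
  simp

theorem lookup_cons_of_ne {α : Type} {k y : ℤ} (h : k ≠ y) (v : α) (l : List (ℤ × α)) :
    ((y, v) :: l).lookup k = l.lookup k := by
  have hb : (k == y) = false := by simpa using h
  simp [List.lookup_cons, hb]

theorem notMem_keys_of_lookup_eq_none {α : Type} {k : ℤ} {l : List (ℤ × α)}
    (h : l.lookup k = none) : k ∉ l.map Prod.fst := by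
  induction l with
  | nil => simp
  | cons e l ih =>
    obtain ⟨y, w⟩ := e
    by_cases hk : k = y
    · subst hk
      simp at h
    · rw [lookup_cons_of_ne hk] at h
      simp only [List.map_cons, List.mem_cons, not_or]
      exact ⟨hk, ih h⟩

namespace HashTable

variable {α : Type}

/-- The bucket array `b` of level `j` holds the entries `es`, in some order in every chain. -/
def Chained (h : HashFn) (j : ℕ) (b : ℕ → List (ℤ × α)) (es : List (ℤ × α)) : Prop :=
  ∀ i : ℕ, (b i).Perm (es.filter fun e => decide ((h j e.1 : ℕ) = i))

/-- A table in a state that insertions of new keys can produce.  The level is determined by the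
number of entries, and the entries not yet copied to the next bucket array are few enough to be
copied before that array is needed. -/
structure Valid (h : HashFn) (T : HashTable α) : Prop where
  count_eq : T.count = T.entries.length
  level_eq : T.level = T.entries.length.size
  nodup : (T.entries.map Prod.fst).Nodup
  chained : Chained h T.level T.buckets T.entries
  next : ∃ copied, (copied ++ T.pending).Perm T.entries ∧
    Chained h (T.level + 1) T.nextBuckets copied
  pending_le : T.pending.length + T.count ≤ 2 ^ T.level

theorem valid_empty (h : HashFn) : Valid h (empty : HashTable α) where
  count_eq := rfl
  level_eq := rfl
  nodup := List.nodup_nil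
  chained := fun _ => List.Perm.refl _
  next := ⟨[], List.Perm.refl _, fun _ => List.Perm.refl _⟩
  pending_le := Nat.zero_le _

theorem Chained.push {h : HashFn} {j : ℕ} {b : ℕ → List (ℤ × α)} {es : List (ℤ × α)}
    (hb : Chained h j b es) (e : ℤ × α) :
    Chained h j (HashTable.push b (h j e.1) e) (e :: es) := by
  intro i
  by_cases hi : (h j e.1 : ℕ) = i
  · subst hi
    simpa [HashTable.push] using (hb _).cons e
  · have hi' : i ≠ (h j e.1 : ℕ) := fun h => hi h.symm
    simpa [HashTable.push, Function.update_of_ne hi', hi] using hb i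

/-- Copying one pending entry keeps the account of which entries have been copied. -/
theorem Chained.copyOne {h : HashFn} {j : ℕ} {b : ℕ → List (ℤ × α)} {es : List (ℤ × α)}
    (hb : Chained h j b es) (pend : List (ℤ × α)) :
    ∃ es', Chained h j (HashTable.copyOne h j b pend) es' ∧
      (es' ++ pend.tail).Perm (es ++ pend) := by
  cases pend with
  | nil => exact ⟨es, hb, List.Perm.refl _⟩
  | cons e pend => exact ⟨e :: es, hb.push e, List.perm_middle.symm⟩

@[simp]
theorem entries_insert (h : HashFn) (T : HashTable α) (k : ℤ) (v : α) :
    (T.insert h k v).entries = (k, v) :: T.entries := by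
  unfold HashTable.insert
  split <;> rfl

theorem Valid.insert {h : HashFn} {T : HashTable α} (hT : Valid h T) {k : ℤ}
    (hk : T.entries.lookup k = none) (v : α) : Valid h (T.insert h k v) := by
  obtain ⟨copied, hperm, hnext⟩ := hT.next
  obtain ⟨copied', hnext', hperm'⟩ := (hnext.push (k, v)).copyOne T.pending
  have hp : (copied' ++ T.pending.tail).Perm ((k, v) :: T.entries) :=
    hperm'.trans (hperm.cons _)
  have hnd : (((k, v) :: T.entries).map Prod.fst).Nodup := by
    simpa using ⟨by simpa using notMem_keys_of_lookup_eq_none hk, hT.nodup⟩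
  have hlt : T.count < 2 ^ T.level := by
    rw [hT.count_eq, hT.level_eq]; exact Nat.lt_size_self _
  have hle := hT.pending_le
  have hc := hT.count_eq
  have hl := hT.level_eq
  rw [← hc] at hl
  unfold HashTable.insert
  split
  · rename_i hfull
    -- A full table has at most one pending entry, and that entry has just been copied.
    have hnil : T.pending.tail = [] := by
      apply List.eq_nil_of_length_eq_zero
      rw [List.length_tail]; omega
    rw [hnil, List.append_nil] at hp
    refine ⟨by simp [hc], ?_, hnd, fun i => (hnext' i).trans (hp.filter _),
      ⟨[], List.Perm.refl _, fun i => List.Perm.refl _⟩, ?_⟩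
    · simp only [List.length_cons, ← hc]
      apply le_antisymm
      · exact Nat.lt_size.2 hfull.ge
      · rw [Nat.size_le, pow_succ]; omega
    · simp only [List.length_cons, ← hc, pow_succ]; omega
  · rename_i hfull
    refine ⟨by simp [hc], ?_, hnd, hT.chained.push (k, v), ⟨copied', hp, hnext'⟩, ?_⟩
    · simp only [List.length_cons, ← hc]
      apply le_antisymm
      · rw [hl]; exact Nat.size_le_size (Nat.le_succ _)
      · rw [Nat.size_le]; omega
    · simp only [List.length_tail]; omega

theorem scan_fst (k : ℤ) : ∀ l : List (ℤ × α), (scan k l).1 = l.lookup k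
  | [] => rfl
  | (y, w) :: l => by
    by_cases hk : k = y
    · subst hk; simp [scan]
    · have hk' : y ≠ k := fun h => hk h.symm
      simp [scan, hk', lookup_cons_of_ne hk, scan_fst k l]

theorem scan_snd_le (k : ℤ) :
    ∀ l : List (ℤ × α), (scan k l).2 ≤ l.countP (fun e => decide (e.1 ≠ k)) + 1
  | [] => by simp [scan]
  | (y, w) :: l => by
    have ih := scan_snd_le k l
    by_cases hk : y = k
    · simp [scan, hk]
    · simp only [scan, hk, if_false]
      rw [List.countP_cons_of_pos (by simpa using hk)]
      omega

/-- The number of keys in a table, other than `k`, that share the bucket of `k`; the level of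
the table is determined by the number of its keys. -/
def collisions (h : HashFn) (keys : List ℤ) (k : ℤ) : ℕ :=
  keys.countP fun y => decide (y ≠ k ∧ h keys.length.size y = h keys.length.size k)

theorem Valid.lookup_fst {h : HashFn} {T : HashTable α} (hT : Valid h T) (k : ℤ) :
    (T.lookup h k).1 = T.entries.lookup k := by
  have hp := hT.chained (h T.level k)
  have hnd : ((T.buckets (h T.level k)).map Prod.fst).Nodup := by
    rw [(hp.map Prod.fst).nodup_iff]
    exact hT.nodup.sublist (List.filter_sublist.map _)
  ext v
  rw [HashTable.lookup, scan_fst, lookup_eq_some_iff_mem hnd, lookup_eq_some_iff_mem hT.nodup,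
    hp.mem_iff]
  simp

theorem Valid.lookup_snd_le {h : HashFn} {T : HashTable α} (hT : Valid h T) (k : ℤ) :
    (T.lookup h k).2 ≤ 2 + collisions h (T.entries.map Prod.fst) k := by
  have h1 := scan_snd_le k (T.buckets (h T.level k))
  rw [(hT.chained (h T.level k)).countP_eq, List.countP_filter] at h1
  have h2 : collisions h (T.entries.map Prod.fst) k = T.entries.countP
      (fun e => decide (e.1 ≠ k) && decide ((h T.level e.1 : ℕ) = (h T.level k : ℕ))) := by
    rw [collisions, List.countP_map, List.length_map, ← hT.level_eq]
    refine List.countP_congr fun e _ => ?_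
    simp [Fin.ext_iff]
  rw [h2, HashTable.lookup]
  dsimp only
  omega

end HashTable

/-! ### Runs of the program, separated from the hash functions -/

/-- What a store holds, apart from the clock and from the arrangement of the entries in buckets.
A run of the program changes the contents in a way that does not depend on the hash functions. -/
@[ext]
structure Contents : Type where
  nextTag : ℕ
  results : List (ℤ × List ℤ)
  heads : List (ℤ × ℕ)
  nextLoc : ℕ
  tails : ℕ → List (ℤ × BList)

def Store.contents (σ : Store) : Contents where
  nextTag := σ.nextTag
  results := σ.results.entries
  heads := σ.heads.entries
  nextLoc := σ.nextLoc
  tails := fun loc => (σ.tails loc).entries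

/-- All tables of the store, with their own hash functions, are in a valid state. -/
structure Store.Valid (H : Hashes) (σ : Store) : Prop where
  results : σ.results.Valid (H .results)
  heads : σ.heads.Valid (H .heads)
  tails : ∀ loc, (σ.tails loc).Valid (H (.tails loc))

theorem Store.Valid.tick {H : Hashes} {σ : Store} (h : σ.Valid H) (k : ℕ) : (σ.tick k).Valid H :=
  ⟨h.results, h.heads, h.tails⟩

@[simp]
theorem Store.clock_tick (σ : Store) (k : ℕ) : (σ.tick k).clock = σ.clock + k := rfl

theorem Store.valid_initial (H : Hashes) : Store.initial.Valid H :=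
  ⟨HashTable.valid_empty _, HashTable.valid_empty _, fun _ => HashTable.valid_empty _⟩

/-- A lookup of `key` in the given table at a moment when it holds the given keys. -/
structure Probe : Type where
  table : TableId
  keys : List ℤ
  key : ℤ

/-- The number of chain cells with other keys that a lookup may examine. -/
def Probe.excess (H : Hashes) (p : Probe) : ℕ := HashTable.collisions (H p.table) p.keys p.key

/-- The total excess of a list of probes. -/
def excess (H : Hashes) (tr : List Probe) : ℕ := (tr.map (Probe.excess H)).sum

@[simp]
theorem excess_append (H : Hashes) (tr tr' : List Probe) :
    excess H (tr ++ tr') = excess H tr + excess H tr' := by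
  simp [excess]

@[simp]
theorem excess_nil (H : Hashes) : excess H [] = 0 := rfl

@[simp]
theorem excess_singleton (H : Hashes) (p : Probe) : excess H [p] = p.excess H := by
  simp [excess]

/-- The computation `R`, started with contents `A`, returns `b` and leaves contents `A'`, and it
takes at most `K` steps besides the collisions met by at most `K` probes.  These probes are the
same for all hash functions, which is what makes their expected cost easy to bound. -/
def Runs {β : Type} (R : Hashes → Store → β → Store → Prop) (A : Contents) (b : β) (A' : Contents)
    (K : ℕ) : Prop :=
  ∃ tr : List Probe, tr.length ≤ K ∧ ∀ (H : Hashes) (σ : Store), σ.Valid H → σ.contents = A →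
    ∃ σ', R H σ b σ' ∧ σ'.Valid H ∧ σ'.contents = A' ∧ σ'.clock ≤ σ.clock + K + excess H tr

/-- The relation between initial store, result and final store given by a function. -/
def Graph {β : Type} (f : Hashes → Store → β × Store) :
    Hashes → Store → β → Store → Prop :=
  fun H σ b σ' => f H σ = (b, σ')

section Composition

variable {β γ δ : Type} {R : Hashes → Store → β → Store → Prop}
  {S : Hashes → Store → γ → Store → Prop} {T : Hashes → Store → δ → Store → Prop}
  {A A' A'' : Contents} {b : β} {c : γ} {d : δ} {K K' : ℕ}

theorem Runs.mono (h : Runs R A b A' K) (hK : K ≤ K') : Runs R A b A' K' := by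
  obtain ⟨tr, htr, h⟩ := h
  refine ⟨tr, htr.trans hK, fun H σ hσ hA => ?_⟩
  obtain ⟨σ', h1, h2, h3, h4⟩ := h H σ hσ hA
  exact ⟨σ', h1, h2, h3, by omega⟩

theorem Runs.comp (h : Runs R A b A' K) (h' : Runs S A' c A'' K')
    (hT : ∀ H σ σ' σ'', R H σ b σ' → S H σ' c σ'' → T H σ d σ'') :
    Runs T A d A'' (K + K') := by
  obtain ⟨tr, htr, h⟩ := h
  obtain ⟨tr', htr', h'⟩ := h'
  refine ⟨tr ++ tr', by rw [List.length_append]; omega, fun H σ hσ hA => ?_⟩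
  obtain ⟨σ', h1, h2, h3, h4⟩ := h H σ hσ hA
  obtain ⟨σ'', k1, k2, k3, k4⟩ := h' H σ' h2 h3
  exact ⟨σ'', hT _ _ _ _ h1 k1, k2, k3, by rw [excess_append]; omega⟩

theorem runs_tick (A : Contents) (k : ℕ) :
    Runs (fun _ σ (_ : Unit) σ' => σ' = σ.tick k) A () A k :=
  ⟨[], Nat.zero_le _, fun _ σ hσ hA => ⟨σ.tick k, rfl, hσ.tick k, hA, by simp⟩⟩

end Composition

/-! ### Single calls -/

theorem runs_boxNil (A : Contents) :
    Runs (Graph fun _ => boxNil) A (.nil A.nextTag) { A with nextTag := A.nextTag + 1 } 1 := by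
  refine ⟨[], Nat.zero_le _, fun H σ hσ hA => ?_⟩
  subst hA
  exact ⟨_, rfl, ⟨hσ.results, hσ.heads, hσ.tails⟩, rfl, by simp⟩

theorem runs_boxCons (x : ℤ) (t : BList) (A : Contents) :
    Runs (Graph fun _ => boxCons x t) A (.cons A.nextTag x t)
      { A with nextTag := A.nextTag + 1 } 1 := by
  refine ⟨[], Nat.zero_le _, fun H σ hσ hA => ?_⟩
  subst hA
  exact ⟨_, rfl, ⟨hσ.results, hσ.heads, hσ.tails⟩, rfl, by simp⟩

theorem runs_innerTable_found {x : ℤ} {A : Contents} {loc : ℕ} (h : A.heads.lookup x = some loc) :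
    Runs (Graph fun H => innerTable H x) A loc A 2 := by
  refine ⟨[⟨.heads, A.heads.map Prod.fst, x⟩], by simp, fun H σ hσ hA => ?_⟩
  subst hA
  have h1 := hσ.heads.lookup_fst x
  have h2 := hσ.heads.lookup_snd_le x
  refine ⟨σ.tick (σ.heads.lookup (H .heads) x).2, ?_, hσ.tick _, rfl, ?_⟩
  · have h3 : (σ.heads.lookup (H .heads) x).1 = some loc := h1.trans h
    simp [Graph, innerTable, h3]
  · simp only [Store.clock_tick, excess_singleton, Probe.excess]
    change _ ≤ _ + HashTable.collisions _ (σ.heads.entries.map Prod.fst) _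
    omega

theorem runs_innerTable_new {x : ℤ} {A : Contents} (h : A.heads.lookup x = none) :
    Runs (Graph fun H => innerTable H x) A A.nextLoc
      { A with
        heads := (x, A.nextLoc) :: A.heads
        tails := Function.update A.tails A.nextLoc []
        nextLoc := A.nextLoc + 1 } 18 := by
  refine ⟨[⟨.heads, A.heads.map Prod.fst, x⟩], by simp, fun H σ hσ hA => ?_⟩
  subst hA
  have h1 := hσ.heads.lookup_fst x
  have h2 := hσ.heads.lookup_snd_le x
  have h3 : (σ.heads.lookup (H .heads) x).1 = none := h1.trans h
  refine ⟨(innerTable H x σ).2, ?_, ?_, ?_, ?_⟩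
  · simp only [Graph, innerTable, h3]
    rfl
  · simp only [innerTable, h3]
    refine ⟨hσ.results, hσ.heads.insert h _, fun loc => ?_⟩
    by_cases hl : loc = σ.nextLoc
    · subst hl
      simpa [Store.tick] using HashTable.valid_empty _
    · simpa [Store.tick, Function.update_of_ne hl] using hσ.tails loc
  · simp only [innerTable, h3]
    ext1 <;> try rfl
    · simp [Store.contents, Store.tick]
    · funext loc
      by_cases hl : loc = σ.nextLoc
      · subst hl
        simp [Store.contents, Store.tick, HashTable.empty]
      · simp [Store.contents, Store.tick, Function.update_of_ne hl]
  · simp only [innerTable, h3]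
    simp only [Store.tick, excess_singleton, Probe.excess, HashTable.newCost,
      HashTable.insertCost]
    change _ ≤ _ + HashTable.collisions _ (σ.heads.entries.map Prod.fst) _
    omega

/-- The part of `hCons` that follows the choice of the inner table. -/
def hConsAt (H : Hashes) (loc : ℕ) (x : ℤ) (t : BList) (σ : Store) : BList × Store :=
  let r := (σ.tails loc).lookup (H (.tails loc)) t.tag
  let σ₂ := σ.tick r.2
  match r.1 with
  | some b => (b, σ₂)
  | none =>
    let q := boxCons x t σ₂
    let σ₃ := q.2
    (q.1,
      { σ₃.tick HashTable.insertCost with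
        tails := Function.update σ₃.tails loc
          ((σ₃.tails loc).insert (H (.tails loc)) t.tag q.1) })

theorem runs_hConsAt_found {x : ℤ} {t b : BList} {A : Contents} {loc : ℕ}
    (h : (A.tails loc).lookup (t.tag : ℤ) = some b) :
    Runs (Graph fun H => hConsAt H loc x t) A b A 2 := by
  refine ⟨[⟨.tails loc, (A.tails loc).map Prod.fst, t.tag⟩], by simp, fun H σ hσ hA => ?_⟩
  subst hA
  have h1 := (hσ.tails loc).lookup_fst t.tag
  have h2 := (hσ.tails loc).lookup_snd_le t.tag
  have h3 : ((σ.tails loc).lookup (H (.tails loc)) t.tag).1 = some b := h1.trans h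
  refine ⟨σ.tick ((σ.tails loc).lookup (H (.tails loc)) t.tag).2, ?_, hσ.tick _, rfl, ?_⟩
  · simp [Graph, hConsAt, h3]
  · simp only [Store.clock_tick, excess_singleton, Probe.excess]
    change _ ≤ _ + HashTable.collisions _ ((σ.tails loc).entries.map Prod.fst) _
    omega

theorem runs_hConsAt_new {x : ℤ} {t : BList} {A : Contents} {loc : ℕ}
    (h : (A.tails loc).lookup (t.tag : ℤ) = none) :
    Runs (Graph fun H => hConsAt H loc x t) A (.cons A.nextTag x t)
      { A with
        nextTag := A.nextTag + 1
        tails := Function.update A.tails loc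
          (((t.tag : ℤ), .cons A.nextTag x t) :: A.tails loc) } 15 := by
  refine ⟨[⟨.tails loc, (A.tails loc).map Prod.fst, t.tag⟩], by simp, fun H σ hσ hA => ?_⟩
  subst hA
  have h1 := (hσ.tails loc).lookup_fst t.tag
  have h2 := (hσ.tails loc).lookup_snd_le t.tag
  have h3 : ((σ.tails loc).lookup (H (.tails loc)) t.tag).1 = none := h1.trans h
  refine ⟨(hConsAt H loc x t σ).2, ?_, ?_, ?_, ?_⟩
  · simp only [Graph, hConsAt, h3]
    rfl
  · simp only [hConsAt, h3]
    refine ⟨hσ.results, hσ.heads, fun loc' => ?_⟩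
    by_cases hl : loc' = loc
    · subst hl
      simpa [Store.tick, boxCons] using (hσ.tails loc').insert h _
    · simpa [Store.tick, boxCons, Function.update_of_ne hl] using hσ.tails loc'
  · simp only [hConsAt, h3]
    ext1 <;> try rfl
    funext loc'
    by_cases hl : loc' = loc
    · subst hl
      simp [Store.contents, Store.tick, boxCons]
    · simp [Store.contents, Store.tick, boxCons, Function.update_of_ne hl]
  · simp only [hConsAt, h3]
    simp only [Store.tick, boxCons, excess_singleton, Probe.excess, HashTable.insertCost]
    change _ ≤ _ + HashTable.collisions _ ((σ.tails loc).entries.map Prod.fst) _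
    omega

theorem Runs.hCons {x : ℤ} {t b : BList} {A A₁ A₂ : Contents} {loc K K' : ℕ}
    (h : Runs (Graph fun H => innerTable H x) A loc A₁ K)
    (h' : Runs (Graph fun H => hConsAt H loc x t) A₁ b A₂ K') :
    Runs (Graph fun H => MemoQuicksort.hCons H x t) A b A₂ (1 + (K + K')) := by
  refine (runs_tick A 1).comp (h.comp h' (d := b)
    (T := Graph fun H σ => hConsAt H (innerTable H x σ).1 x t (innerTable H x σ).2) ?_) ?_
  · intro H σ σ' σ'' h1 h2
    simp only [Graph] at *
    rw [h1]
    exact h2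
  · rintro H σ σ' σ'' rfl h2
    exact h2

theorem runs_mfil_nil (g : ℤ → Bool) (n : ℕ) (A : Contents) :
    Runs (Graph fun H => mfil H g (.nil n)) A emptyBox A 1 :=
  ⟨[], Nat.zero_le _, fun _ σ hσ hA => ⟨σ.tick 1, rfl, hσ.tick 1, hA, by simp⟩⟩

theorem Runs.mfil_neg {g : ℤ → Bool} {n : ℕ} {x : ℤ} {t b : BList} {A A' : Contents} {K : ℕ}
    (hx : g x = false) (h : Runs (Graph fun H => mfil H g t) A b A' K) :
    Runs (Graph fun H => mfil H g (.cons n x t)) A b A' (1 + (K + 1)) := by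
  refine (runs_tick A 1).comp (h.comp (runs_tick A' 1) (d := b)
    (T := Graph fun H σ => ((mfil H g t σ).1, (mfil H g t σ).2.tick 1)) ?_) ?_
  · rintro H σ σ' σ'' h1 rfl
    simp only [Graph] at *
    rw [h1]
  · rintro H σ σ' σ'' rfl h2
    simpa [Graph, mfil, hx] using h2

theorem Runs.mfil_pos {g : ℤ → Bool} {n : ℕ} {x : ℤ} {t b d : BList} {A A₁ A₂ : Contents}
    {K K' : ℕ} (hx : g x = true) (h : Runs (Graph fun H => mfil H g t) A b A₁ K)
    (h' : Runs (Graph fun H => MemoQuicksort.hCons H x b) A₁ d A₂ K') :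
    Runs (Graph fun H => mfil H g (.cons n x t)) A d A₂ (1 + (K + (1 + K'))) := by
  refine (runs_tick A 1).comp (h.comp ((runs_tick A₁ 1).comp h' (d := d)
    (T := Graph fun H σ => MemoQuicksort.hCons H x b (σ.tick 1)) ?_) (d := d)
    (T := Graph fun H σ => MemoQuicksort.hCons H x (mfil H g t σ).1
      ((mfil H g t σ).2.tick 1)) ?_) ?_
  · rintro H σ σ' σ'' rfl h2
    exact h2
  · intro H σ σ' σ'' h1 h2
    simp only [Graph] at *
    rw [h1]
    exact h2
  · rintro H σ σ' σ'' rfl h2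
    simpa [Graph, mfil, hx] using h2

/-- Consulting the memo table of Quicksort reports what the contents associate with the tag. -/
theorem runs_consult (l : BList) (A : Contents) :
    Runs (fun H σ r σ' => r = stored H l σ ∧ σ' = consult H l σ) A
      (A.results.lookup (l.tag : ℤ)) A 3 := by
  refine ⟨[⟨.results, A.results.map Prod.fst, l.tag⟩], by simp, fun H σ hσ hA => ?_⟩
  subst hA
  have h2 := hσ.results.lookup_snd_le l.tag
  refine ⟨_, ⟨(hσ.results.lookup_fst l.tag).symm, rfl⟩, hσ.tick _, rfl, ?_⟩
  simp only [consult, Store.clock_tick, excess_singleton, Probe.excess]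
  change _ ≤ _ + HashTable.collisions _ (σ.results.entries.map Prod.fst) _
  omega

theorem runs_memoize {l : BList} {A : Contents} (h : A.results.lookup (l.tag : ℤ) = none)
    (v : List ℤ) :
    Runs (fun H σ (_ : Unit) σ' => σ' = memoize H l v σ) A ()
      { A with results := ((l.tag : ℤ), v) :: A.results } 12 := by
  refine ⟨[], Nat.zero_le _, fun H σ hσ hA => ?_⟩
  subst hA
  refine ⟨_, rfl, ⟨hσ.results.insert h v, hσ.heads, hσ.tails⟩, ?_, ?_⟩
  · ext1 <;> simp [Store.contents, memoize, Store.tick]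
  · simp [memoize, Store.tick, HashTable.insertCost]

/-- The semantics of Quicksort on the list `l` as a relation of the form expected by `Runs`. -/
def MqsRel (l : BList) : Hashes → Store → List ℤ → Store → Prop := fun H σ v σ' => Mqs H l σ v σ'

theorem runs_mqs_found {l : BList} {A : Contents} {v : List ℤ}
    (h : A.results.lookup (l.tag : ℤ) = some v) : Runs (MqsRel l) A v A 3 := by
  refine (runs_consult l A).comp (runs_tick A 0) ?_
  rintro H σ σ' σ'' ⟨h1, rfl⟩ rfl
  exact Mqs.found (h1.symm.trans h)

theorem runs_mqs_nil {n : ℕ} {A : Contents} (h : A.results.lookup (n : ℤ) = none) :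
    Runs (MqsRel (.nil n)) A [] { A with results := ((n : ℤ), []) :: A.results } 16 := by
  refine (runs_consult (.nil n) A).comp ((runs_tick A 1).comp
    (runs_memoize (l := .nil n) h []) (d := ())
    (T := fun H σ (_ : Unit) σ' => σ' = memoize H (.nil n) [] (σ.tick 1)) ?_) ?_
  · rintro H σ σ' σ'' rfl rfl
    rfl
  · rintro H σ σ' σ'' ⟨h1, rfl⟩ rfl
    exact Mqs.nil (h1.symm.trans h)

theorem Runs.mqs_cons {n : ℕ} {x : ℤ} {t s g : BList} {A A₁ A₂ A₃ A₄ : Contents}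
    {ss gg : List ℤ} {K₁ K₂ K₃ K₄ : ℕ} (h : A.results.lookup (n : ℤ) = none)
    (hs : Runs (Graph fun H => lesser H x t) A s A₁ K₁)
    (hg : Runs (Graph fun H => greater H x t) A₁ g A₂ K₂)
    (hss : Runs (MqsRel s) A₂ ss A₃ K₃) (hgg : Runs (MqsRel g) A₃ gg A₄ K₄)
    (h' : A₄.results.lookup (n : ℤ) = none) :
    Runs (MqsRel (.cons n x t)) A (ss ++ x :: gg)
      { A₄ with results := ((n : ℤ), ss ++ x :: gg) :: A₄.results }
      (K₁ + K₂ + K₃ + K₄ + ss.length + 18) := by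
  set l := BList.cons n x t
  set v := ss ++ x :: gg
  have e1 : Runs (fun H σ (_ : Unit) σ' => σ' = memoize H l v (σ.tick (ss.length + 2))) A₄ ()
      { A₄ with results := ((n : ℤ), v) :: A₄.results } (ss.length + 2 + 12) :=
    (runs_tick A₄ (ss.length + 2)).comp (runs_memoize (l := l) h' v)
      (by rintro H σ σ' σ'' rfl rfl; rfl)
  have e2 := hgg.comp e1 (d := ()) (T := fun H σ (_ : Unit) σ' =>
      ∃ σ₄, Mqs H g σ gg σ₄ ∧ σ' = memoize H l v (σ₄.tick (ss.length + 2)))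
    (by rintro H σ σ' σ'' h1 rfl; exact ⟨_, h1, rfl⟩)
  have e3 := hss.comp e2 (d := ()) (T := fun H σ (_ : Unit) σ' =>
      ∃ σ₃ σ₄, Mqs H s σ ss σ₃ ∧ Mqs H g σ₃ gg σ₄ ∧
        σ' = memoize H l v (σ₄.tick (ss.length + 2)))
    (by rintro H σ σ' σ'' h1 ⟨σ₄, h2, rfl⟩; exact ⟨_, _, h1, h2, rfl⟩)
  have e4 := hg.comp e3 (d := ()) (T := fun H σ (_ : Unit) σ' =>
      ∃ σ₂ σ₃ σ₄, greater H x t σ = (g, σ₂) ∧ Mqs H s σ₂ ss σ₃ ∧ Mqs H g σ₃ gg σ₄ ∧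
        σ' = memoize H l v (σ₄.tick (ss.length + 2)))
    (by rintro H σ σ' σ'' h1 ⟨σ₃, σ₄, h2, h3, rfl⟩; exact ⟨_, _, _, h1, h2, h3, rfl⟩)
  have e5 := hs.comp e4 (d := ()) (T := fun H σ (_ : Unit) σ' =>
      ∃ σ₁ σ₂ σ₃ σ₄, lesser H x t σ = (s, σ₁) ∧ greater H x t σ₁ = (g, σ₂) ∧
        Mqs H s σ₂ ss σ₃ ∧ Mqs H g σ₃ gg σ₄ ∧
        σ' = memoize H l v (σ₄.tick (ss.length + 2)))
    (by
      rintro H σ σ' σ'' h1 ⟨σ₂, σ₃, σ₄, h2, h3, h4, rfl⟩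
      exact ⟨_, _, _, _, h1, h2, h3, h4, rfl⟩)
  have e6 := (runs_tick A 1).comp e5 (d := ()) (T := fun H σ (_ : Unit) σ' =>
      ∃ σ₁ σ₂ σ₃ σ₄, lesser H x t (σ.tick 1) = (s, σ₁) ∧ greater H x t σ₁ = (g, σ₂) ∧
        Mqs H s σ₂ ss σ₃ ∧ Mqs H g σ₃ gg σ₄ ∧
        σ' = memoize H l v (σ₄.tick (ss.length + 2)))
    (by rintro H σ σ' σ'' rfl h2; exact h2)
  refine ((runs_consult l A).comp e6 (d := v) (T := MqsRel l) ?_).mono (by omega)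
  rintro H σ σ' σ'' ⟨h1, rfl⟩ ⟨σ₁, σ₂, σ₃, σ₄, h2, h3, h4, h5, rfl⟩
  exact Mqs.cons (h1.symm.trans h) h2 h3 h4 h5

/-! ### Hash-consed lists and the memo table of Quicksort -/

/-- The keys of a boxed list. -/
def BList.toList : BList → List ℤ
  | .nil _ => []
  | .cons _ x t => x :: t.toList

namespace Contents

/-- The box that the nested memo table of `hCons` stores for a head and the tag of a tail. -/
def find (A : Contents) (x u : ℤ) : Option BList :=
  (A.heads.lookup x).bind fun loc => (A.tails loc).lookup u

/-- Different heads have different inner tables, and these have been allocated. -/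
structure HeadsOk (A : Contents) : Prop where
  lt : ∀ x loc, A.heads.lookup x = some loc → loc < A.nextLoc
  inj : ∀ x y loc, A.heads.lookup x = some loc → A.heads.lookup y = some loc → x = y

/-- The hash-consed boxes: `emptyBox` and the boxes stored by `hCons` for hash-consed tails. -/
inductive Canon (A : Contents) : BList → Prop
  | nil : Canon A emptyBox
  | cons {n : ℕ} {x : ℤ} {t : BList} : Canon A t →
      A.find x (t.tag : ℤ) = some (.cons n x t) → Canon A (.cons n x t)

/-- The boxes on which Quicksort may be called: the hash-consed ones, and the input list `r`,
which the caller may have built in another way. -/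
def Known (A : Contents) (r b : BList) : Prop := A.Canon b ∨ b = r

/-- The list `K` has a hash-consed box, for which the result of Quicksort is stored. -/
def Done (A : Contents) (K : List ℤ) : Prop :=
  ∃ b v, A.Canon b ∧ b.toList = K ∧ A.results.lookup (b.tag : ℤ) = some v

/-- Both recursive calls for the list `K` are done. -/
def Ready (A : Contents) : List ℤ → Prop
  | [] => True
  | x :: K => A.Done (K.filter fun y => decide (y < x)) ∧ A.Done (K.filter fun y => decide (y ≥ x))

/-- The invariant of the program, for the input list `r`: hash-consing is correct, tags identify
the boxes on which Quicksort may be called, and the memo table of Quicksort is closed under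
recursive calls. -/
structure Inv (A : Contents) (r : BList) : Prop where
  heads : A.HeadsOk
  find : ∀ x u b, A.find x u = some b → ∃ n t, b = .cons n x t ∧ (t.tag : ℤ) = u ∧ A.Canon t
  tag_lt : ∀ b, A.Known r b → b.tag < A.nextTag
  tag_inj : ∀ b b', A.Known r b → A.Known r b' → b.tag = b'.tag → b = b'
  key_lt : ∀ k v, A.results.lookup k = some v → k < A.nextTag
  results : ∀ b v, A.Known r b → A.results.lookup (b.tag : ℤ) = some v →
    v.length = b.toList.length ∧ A.Ready b.toList

/-- Nothing is removed from the memo tables. -/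
structure Ext (A A' : Contents) : Prop where
  find : ∀ x u b, A.find x u = some b → A'.find x u = some b
  results : ∀ k v, A.results.lookup k = some v → A'.results.lookup k = some v

theorem Ext.refl (A : Contents) : A.Ext A := ⟨fun _ _ _ h => h, fun _ _ h => h⟩

theorem Ext.trans {A A' A'' : Contents} (h : A.Ext A') (h' : A'.Ext A'') : A.Ext A'' :=
  ⟨fun x u b hb => h'.find x u b (h.find x u b hb), fun k v hk => h'.results k v (h.results k v hk)⟩

theorem Canon.ext {A A' : Contents} {b : BList} (hb : A.Canon b) (h : A.Ext A') : A'.Canon b := by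
  induction hb with
  | nil => exact .nil
  | cons _ hf ih => exact .cons ih (h.find _ _ _ hf)

theorem Known.ext {A A' : Contents} {r b : BList} (hb : A.Known r b) (h : A.Ext A') :
    A'.Known r b :=
  hb.imp (fun hc => hc.ext h) id

theorem Done.ext {A A' : Contents} {K : List ℤ} (hK : A.Done K) (h : A.Ext A') : A'.Done K := by
  obtain ⟨b, v, hb, hbK, hv⟩ := hK
  exact ⟨b, v, hb.ext h, hbK, h.results _ _ hv⟩

theorem Ready.ext {A A' : Contents} {K : List ℤ} (hK : A.Ready K) (h : A.Ext A') : A'.Ready K := by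
  cases K with
  | nil => trivial
  | cons x K => exact ⟨hK.1.ext h, hK.2.ext h⟩

theorem Canon.of_find_eq {A A' : Contents} {b : BList} (hb : A.Canon b) (h : A'.find = A.find) :
    A'.Canon b := by
  induction hb with
  | nil => exact .nil
  | cons _ hf ih => exact .cons ih (by rw [h]; exact hf)

/-- Hash-consing: there is one box for each list. -/
theorem Canon.unique {A : Contents} {b : BList} (hb : A.Canon b) :
    ∀ {b' : BList}, A.Canon b' → b.toList = b'.toList → b = b' := by
  induction hb with
  | nil =>
    intro b' hb' h
    cases hb' with
    | nil => rfl
    | cons _ _ => simp [emptyBox, BList.toList] at h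
  | cons _ hf ih =>
    intro b' hb' h
    cases hb' with
    | nil => simp [emptyBox, BList.toList] at h
    | cons ht' hf' =>
      simp only [BList.toList, List.cons.injEq] at h
      obtain ⟨rfl, h⟩ := h
      obtain rfl := ih ht' h
      exact Option.some_injective _ (hf.symm.trans hf')

/-- The invariant also holds for a hash-consed list in the role of the input list. -/
theorem Inv.of_canon {A : Contents} {r b : BList} (h : A.Inv r) (hb : A.Canon b) : A.Inv b := by
  have hk : ∀ b', A.Known b b' → A.Known r b' := fun b' hb' =>
    hb'.elim Or.inl (fun h => Or.inl (h ▸ hb))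
  exact ⟨h.heads, h.find, fun b hb => h.tag_lt b (hk b hb),
    fun b b' hb hb' => h.tag_inj b b' (hk b hb) (hk b' hb'), h.key_lt,
    fun b v hb => h.results b v (hk b hb)⟩

/-- The box stored for a head and the tag of a hash-consed tail has this head and this tail. -/
theorem Inv.find_eq {A : Contents} {r : BList} (h : A.Inv r) {x : ℤ} {t b : BList}
    (ht : A.Canon t) (hb : A.find x (t.tag : ℤ) = some b) :
    A.Canon b ∧ b.toList = x :: t.toList := by
  obtain ⟨n, t', rfl, htag, ht'⟩ := h.find _ _ _ hb
  obtain rfl := h.tag_inj t' t (Or.inl ht') (Or.inl ht) (by exact_mod_cast htag)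
  exact ⟨.cons ht' hb, rfl⟩

theorem Inv.lookup_nextTag {A : Contents} {r : BList} (h : A.Inv r) :
    A.results.lookup (A.nextTag : ℤ) = none := by
  cases hv : A.results.lookup (A.nextTag : ℤ) with
  | none => rfl
  | some v => exact absurd (h.key_lt _ _ hv) (lt_irrefl _)

theorem Canon.exists_result {A : Contents} {b : BList} (hb : A.Canon b)
    (hd : A.Done b.toList) : ∃ v, A.results.lookup (b.tag : ℤ) = some v := by
  obtain ⟨b', v, hb', he, hv⟩ := hd
  obtain rfl := hb'.unique hb he
  exact ⟨v, hv⟩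

theorem Inv.ready_of_done {A : Contents} {r : BList} (h : A.Inv r) {K : List ℤ}
    (hd : A.Done K) : A.Ready K := by
  obtain ⟨b, v, hb, rfl, hv⟩ := hd
  exact (h.results b v (Or.inl hb) hv).2

/-! ### Specifications of the functions -/

theorem exists_runs_innerTable {A : Contents} (hA : A.HeadsOk) (x : ℤ) :
    ∃ loc A', Runs (Graph fun H => innerTable H x) A loc A' 18 ∧ A'.HeadsOk ∧
      A'.heads.lookup x = some loc ∧ A'.find = A.find ∧ A'.nextTag = A.nextTag ∧
      A'.results = A.results := by
  cases hx : A.heads.lookup x with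
  | some loc => exact ⟨loc, A, (runs_innerTable_found hx).mono (by norm_num), hA, hx, rfl, rfl, rfl⟩
  | none =>
    have hlook : ∀ y, ((x, A.nextLoc) :: A.heads).lookup y =
        if y = x then some A.nextLoc else A.heads.lookup y := by
      intro y
      by_cases hy : y = x
      · subst hy; simp
      · rw [lookup_cons_of_ne hy, if_neg hy]
    refine ⟨_, _, runs_innerTable_new hx, ⟨?_, ?_⟩, by simp, ?_, rfl, rfl⟩
    · intro y loc h
      simp only [hlook] at h ⊢
      split_ifs at h
      · obtain rfl := Option.some_injective _ h
        exact Nat.lt_succ_self _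
      · exact (hA.lt y loc h).trans (Nat.lt_succ_self _)
    · intro y z loc h h'
      simp only [hlook] at h h'
      split_ifs at h h' with h1 h2 h2
      · rw [h1, h2]
      · obtain rfl := Option.some_injective _ h
        exact absurd (hA.lt z _ h') (lt_irrefl _)
      · obtain rfl := Option.some_injective _ h'
        exact absurd (hA.lt y _ h) (lt_irrefl _)
      · exact hA.inj y z loc h h'
    · funext y u
      simp only [find, hlook]
      split_ifs with h
      · subst h
        simp [hx]
      · cases hy : A.heads.lookup y with
        | none => rfl
        | some loc =>
          have hne := (hA.lt y loc hy).ne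
          simp [Function.update_of_ne hne]

/-- Hash-consing either returns the stored box or stores a new one. -/
theorem exists_runs_hCons_find {A : Contents} (hA : A.HeadsOk) (x : ℤ) (t : BList) :
    ∃ b A', Runs (Graph fun H => MemoQuicksort.hCons H x t) A b A' 34 ∧ A'.HeadsOk ∧
      A'.results = A.results ∧
      ((A.find x (t.tag : ℤ) = some b ∧ A'.find = A.find ∧ A'.nextTag = A.nextTag) ∨
        (A.find x (t.tag : ℤ) = none ∧ b = .cons A.nextTag x t ∧ A'.nextTag = A.nextTag + 1 ∧
          ∀ y u, A'.find y u = if y = x ∧ u = t.tag then some b else A.find y u)) := by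
  obtain ⟨loc, A₁, h1, hA₁, hloc, hfind, htag, hres⟩ := exists_runs_innerTable hA x
  have hf : A.find x (t.tag : ℤ) = (A₁.tails loc).lookup (t.tag : ℤ) := by
    rw [← hfind]; simp [find, hloc]
  cases hb : (A₁.tails loc).lookup (t.tag : ℤ) with
  | some b =>
    exact ⟨b, A₁, (h1.hCons (runs_hConsAt_found hb)).mono (by norm_num), hA₁, hres,
      Or.inl ⟨hf.trans hb, hfind, htag⟩⟩
  | none =>
    refine ⟨_, _, (h1.hCons (runs_hConsAt_new hb)).mono (by norm_num), ⟨hA₁.lt, hA₁.inj⟩, hres,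
      Or.inr ⟨hf.trans hb, by rw [htag], by simp [htag], ?_⟩⟩
    intro y u
    rw [← hfind]
    simp only [find]
    by_cases hy : y = x
    · subst hy
      simp only [hloc, Option.bind_some, Function.update_self, true_and]
      by_cases hu : u = t.tag
      · subst hu; simp
      · rw [lookup_cons_of_ne hu, if_neg hu]
    · simp only [hy, false_and, if_false]
      cases hl : A₁.heads.lookup y with
      | none => rfl
      | some loc' =>
        have hne : loc' ≠ loc := fun h => hy (hA₁.inj y x loc (h ▸ hl) hloc)
        simp [Function.update_of_ne hne]

theorem exists_runs_hCons {A : Contents} {r : BList} (hA : A.Inv r) (x : ℤ) {t : BList}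
    (ht : A.Canon t) :
    ∃ b A', Runs (Graph fun H => MemoQuicksort.hCons H x t) A b A' 34 ∧ A'.Inv r ∧ A.Ext A' ∧
      A'.results = A.results ∧ A'.Canon b ∧ b.toList = x :: t.toList := by
  obtain ⟨b, A', hrun, hheads, hres, ⟨hf, hf', htag⟩ | ⟨hf, hb, htag, hf'⟩⟩ :=
    exists_runs_hCons_find hA.heads x t
  · have hext : A.Ext A' := ⟨fun y u b h => by rw [hf']; exact h, fun k v h => by rw [hres]; exact h⟩
    have hcanon : ∀ b, A'.Canon b → A.Canon b := fun b hb => hb.of_find_eq hf'.symm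
    have hknown : ∀ b, A'.Known r b → A.Known r b := fun b hb => hb.imp (hcanon b) id
    obtain ⟨hb, hl⟩ := hA.find_eq ht hf
    refine ⟨b, A', hrun, ⟨hheads, ?_, ?_, ?_, ?_, ?_⟩, hext, hres, hb.ext hext, hl⟩
    · intro y u b h
      obtain ⟨n, t', h1, h2, h3⟩ := hA.find y u b (by rw [← hf']; exact h)
      exact ⟨n, t', h1, h2, h3.ext hext⟩
    · intro b hb; rw [htag]; exact hA.tag_lt b (hknown b hb)
    · intro b b' hb hb'; exact hA.tag_inj b b' (hknown b hb) (hknown b' hb')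
    · intro k v h; rw [htag]; exact hA.key_lt k v (by rw [← hres]; exact h)
    · intro b v hb h
      obtain ⟨h1, h2⟩ := hA.results b v (hknown b hb) (by rw [← hres]; exact h)
      exact ⟨h1, h2.ext hext⟩
  · have hext : A.Ext A' := by
      refine ⟨fun y u b' h => ?_, fun k v h => by rw [hres]; exact h⟩
      rw [hf', if_neg]
      · exact h
      · rintro ⟨rfl, rfl⟩
        rw [hf] at h
        cases h
    have hcb : A'.Canon b := by
      subst hb
      exact .cons (ht.ext hext) (by rw [hf', if_pos ⟨rfl, rfl⟩])
    have hcanon : ∀ b', A'.Canon b' → A.Canon b' ∨ b' = b := by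
      intro b' hb'
      induction hb' with
      | nil => exact Or.inl .nil
      | @cons n y t' _ hft _ =>
        rw [hf'] at hft
        split_ifs at hft with hc
        · exact Or.inr (Option.some_injective _ hft).symm
        · obtain ⟨n', t'', he, _, hc'⟩ := hA.find _ _ _ hft
          cases he
          exact Or.inl (.cons hc' hft)
    have hknown : ∀ b', A'.Known r b' → A.Known r b' ∨ b' = b := by
      rintro b' (h | h)
      · exact (hcanon b' h).imp Or.inl id
      · exact Or.inl (Or.inr h)
    have hbtag : b.tag = A.nextTag := by rw [hb]; rfl
    refine ⟨b, A', hrun, ⟨hheads, ?_, ?_, ?_, ?_, ?_⟩, hext, hres, hcb, by rw [hb]; rfl⟩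
    · intro y u b' h
      rw [hf'] at h
      split_ifs at h with hc
      · obtain rfl := Option.some_injective _ h
        exact ⟨A.nextTag, t, by rw [hc.1]; exact hb, hc.2.symm, ht.ext hext⟩
      · obtain ⟨n, t', h1, h2, h3⟩ := hA.find y u b' h
        exact ⟨n, t', h1, h2, h3.ext hext⟩
    · intro b' hb'
      rw [htag]
      rcases hknown b' hb' with h | rfl
      · exact (hA.tag_lt b' h).trans (Nat.lt_succ_self _)
      · rw [hbtag]; exact Nat.lt_succ_self _
    · intro b' b'' hb' hb'' he
      rcases hknown b' hb' with h | rfl <;> rcases hknown b'' hb'' with h' | rfl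
      · exact hA.tag_inj b' b'' h h' he
      · exact absurd (he.trans hbtag) (hA.tag_lt b' h).ne
      · exact absurd (he.symm.trans hbtag) (hA.tag_lt b'' h').ne
      · rfl
    · intro k v h
      rw [htag]
      have := hA.key_lt k v (by rw [← hres]; exact h)
      push_cast
      omega
    · intro b' v hb' h
      rw [hres] at h
      rcases hknown b' hb' with h' | rfl
      · obtain ⟨h1, h2⟩ := hA.results b' v h' h
        exact ⟨h1, h2.ext hext⟩
      · rw [hbtag, hA.lookup_nextTag] at h
        cases h

/-- Filtering yields the hash-consed box of the filtered list. -/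
theorem exists_runs_mfil (g : ℤ → Bool) (l : BList) {A : Contents} {r : BList} (hA : A.Inv r) :
    ∃ b A', Runs (Graph fun H => mfil H g l) A b A' (36 * (l.toList.length + 1)) ∧ A'.Inv r ∧
      A.Ext A' ∧ A'.results = A.results ∧ A'.Canon b ∧ b.toList = l.toList.filter g := by
  induction l with
  | nil n =>
    exact ⟨emptyBox, A, (runs_mfil_nil g n A).mono (by omega), hA, .refl A, rfl, .nil, rfl⟩
  | cons n x t ih =>
    obtain ⟨b, A₁, h1, hA₁, hext, hres, hb, hl⟩ := ih
    cases hx : g x with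
    | false =>
      refine ⟨b, A₁, (Runs.mfil_neg hx h1).mono ?_, hA₁, hext, hres, hb, ?_⟩
      · simp only [BList.toList, List.length_cons]; omega
      · simp [BList.toList, hx, hl]
    | true =>
      obtain ⟨d, A₂, h2, hA₂, hext', hres', hd, hl'⟩ := exists_runs_hCons hA₁ x hb
      refine ⟨d, A₂, (Runs.mfil_pos hx h1 h2).mono ?_, hA₂, hext.trans hext', hres'.trans hres,
        hd, ?_⟩
      · simp only [BList.toList, List.length_cons]; omega
      · simp [BList.toList, hx, hl, hl']

/-- Allocating a new box, which becomes the input list, preserves the invariant. -/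
theorem Inv.alloc {A : Contents} {r b : BList} (hA : A.Inv r) (hb : b.tag = A.nextTag) :
    ({ A with nextTag := A.nextTag + 1 } : Contents).Inv b ∧
      A.Ext { A with nextTag := A.nextTag + 1 } := by
  set A' : Contents := { A with nextTag := A.nextTag + 1 } with hA'
  have hext : A.Ext A' := ⟨fun _ _ _ h => h, fun _ _ h => h⟩
  have hcanon : ∀ b', A'.Canon b' → A.Canon b' := fun b' h => h.of_find_eq rfl
  refine ⟨⟨⟨hA.heads.lt, hA.heads.inj⟩, ?_, ?_, ?_, ?_, ?_⟩, hext⟩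
  · intro y u b' h
    obtain ⟨n, t', h1, h2, h3⟩ := hA.find y u b' h
    exact ⟨n, t', h1, h2, h3.ext hext⟩
  · rintro b' (h | rfl)
    · exact (hA.tag_lt b' (Or.inl (hcanon b' h))).trans (Nat.lt_succ_self _)
    · rw [hb]; exact Nat.lt_succ_self _
  · rintro b' b'' (h | rfl) (h' | rfl) he
    · exact hA.tag_inj b' b'' (Or.inl (hcanon b' h)) (Or.inl (hcanon b'' h')) he
    · exact absurd (he.trans hb) (hA.tag_lt b' (Or.inl (hcanon b' h))).ne
    · exact absurd (he.symm.trans hb) (hA.tag_lt b'' (Or.inl (hcanon b'' h'))).ne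
    · rfl
  · intro k v h
    have := hA.key_lt k v h
    change k < ((A.nextTag + 1 : ℕ) : ℤ)
    push_cast
    omega
  · rintro b' v (h' | rfl) h
    · obtain ⟨h1, h2⟩ := hA.results b' v (Or.inl (hcanon b' h')) h
      exact ⟨h1, h2.ext hext⟩
    · rw [hb] at h
      exact absurd (h.symm.trans hA.lookup_nextTag) (by simp)

theorem exists_runs_inputCons {A : Contents} {r : BList} (hA : A.Inv r) (shared : Bool) (x : ℤ)
    {t : BList} (ht : shared = true → A.Canon t) :
    ∃ b A' K, Runs (Graph fun H => inputCons H shared x t) A b A' K ∧ A'.Inv b ∧ A.Ext A' ∧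
      (shared = true → A'.Canon b) ∧ b.toList = x :: t.toList := by
  cases shared with
  | true =>
    obtain ⟨b, A', h1, h2, h3, _, h5, h6⟩ := exists_runs_hCons hA x (ht rfl)
    exact ⟨b, A', 34, h1, h2.of_canon h5, h3, fun _ => h5, h6⟩
  | false =>
    obtain ⟨h1, h2⟩ := hA.alloc (b := .cons A.nextTag x t) rfl
    exact ⟨_, _, 1, runs_boxCons x t A, h1, h2, by simp, rfl⟩

theorem exists_runs_inputList {A : Contents} {r : BList} (hA : A.Inv r) (shared : Bool)
    (L : List ℤ) :
    ∃ b A' K, Runs (Graph fun H => inputList H shared L) A b A' K ∧ A'.Inv b ∧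
      (shared = true → A'.Canon b) ∧ b.toList = L := by
  induction L with
  | nil =>
    cases shared with
    | true =>
      refine ⟨emptyBox, A, 0, ?_, hA.of_canon .nil, fun _ => .nil, rfl⟩
      exact ⟨[], le_rfl, fun H σ hσ h => ⟨σ, by simp [Graph, inputList], hσ, h, by simp⟩⟩
    | false =>
      exact ⟨_, _, 1, runs_boxNil A, (hA.alloc (b := .nil A.nextTag) rfl).1, by simp, rfl⟩
  | cons x L ih =>
    obtain ⟨t, A₁, K, h1, h2, h3, h4⟩ := ih
    obtain ⟨b, A₂, K', h5, h6, _, h7, h8⟩ := exists_runs_inputCons h2 shared x h3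
    refine ⟨b, A₂, K + K', h1.comp h5 ?_, h6, h7, by rw [h8, h4]⟩
    intro H σ σ' σ'' e1 e2
    simp only [Graph, inputList] at *
    rw [e1]
    exact e2

theorem inv_initial : Store.initial.contents.Inv emptyBox := by
  have hf : ∀ x u b, Store.initial.contents.find x u ≠ some b := by
    intro x u b h
    simp [find, Store.contents, Store.initial, HashTable.empty] at h
  have hr : ∀ k v, Store.initial.contents.results.lookup k ≠ some v := by
    intro k v h
    simp [Store.contents, Store.initial, HashTable.empty] at h
  have hk : ∀ b, Store.initial.contents.Known emptyBox b → b = emptyBox := by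
    rintro b (h | h)
    · cases h with
      | nil => rfl
      | cons _ h => exact absurd h (hf _ _ _)
    · exact h
  refine ⟨⟨?_, ?_⟩, fun x u b h => absurd h (hf _ _ _), ?_, ?_, fun k v h => absurd h (hr _ _),
    fun b v _ h => absurd h (hr _ _)⟩
  · intro x loc h
    simp [Store.contents, Store.initial, HashTable.empty] at h
  · intro x y loc h
    simp [Store.contents, Store.initial, HashTable.empty] at h
  · intro b hb
    rw [hk b hb]
    exact Nat.zero_lt_one
  · intro b b' hb hb' _
    rw [hk b hb, hk b' hb']

/-! ### Calls of Quicksort -/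

/-- The effect of a call of Quicksort on `l`: its result is stored, and nothing is entered into
the memo table for lists longer than `l`. -/
structure Called (A : Contents) (r l : BList) (v : List ℤ) (A' : Contents) : Prop where
  inv : A'.Inv r
  ext : A.Ext A'
  result : A'.results.lookup (l.tag : ℤ) = some v
  frame : ∀ b, A.Known r b → l.toList.length < b.toList.length →
    A'.results.lookup (b.tag : ℤ) = A.results.lookup (b.tag : ℤ)

theorem Called.length_eq {A A' : Contents} {r l : BList} {v : List ℤ} (h : A.Called r l v A')
    (hl : A.Known r l) : v.length = l.toList.length :=
  (h.inv.results l v (hl.ext h.ext) h.result).1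

theorem Called.done {A A' : Contents} {r l : BList} {v : List ℤ} (h : A.Called r l v A')
    (hl : A.Canon l) : A'.Done l.toList :=
  ⟨l, v, hl.ext h.ext, rfl, h.result⟩

theorem exists_runs_mqs_found {A : Contents} {r l : BList} (hA : A.Inv r) {v : List ℤ}
    (hv : A.results.lookup (l.tag : ℤ) = some v) :
    Runs (MqsRel l) A v A 3 ∧ A.Called r l v A :=
  ⟨runs_mqs_found hv, hA, .refl A, hv, fun _ _ _ => rfl⟩

/-- Entering the result of a list into the memo table of Quicksort preserves the invariant. -/
theorem Inv.memoize {A : Contents} {r l : BList} (hA : A.Inv r) (hl : A.Known r l)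
    (hn : A.results.lookup (l.tag : ℤ) = none) {v : List ℤ} (hv : v.length = l.toList.length)
    (hr : A.Ready l.toList) :
    A.Called r l v { A with results := ((l.tag : ℤ), v) :: A.results } := by
  set A' : Contents := { A with results := ((l.tag : ℤ), v) :: A.results } with hA'
  have hlook : ∀ k, k ≠ (l.tag : ℤ) → A'.results.lookup k = A.results.lookup k :=
    fun k hk => lookup_cons_of_ne hk _ _
  have hself : A'.results.lookup (l.tag : ℤ) = some v := lookup_cons_self _ _ _
  have hext : A.Ext A' := by
    refine ⟨fun _ _ _ h => h, fun k w h => ?_⟩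
    rw [hlook]
    · exact h
    · rintro rfl
      rw [hn] at h
      cases h
  have hknown : ∀ b, A'.Known r b → A.Known r b := fun b h => h.imp (fun h => h.of_find_eq rfl) id
  refine ⟨⟨⟨hA.heads.lt, hA.heads.inj⟩, ?_, fun b hb => hA.tag_lt b (hknown b hb),
    fun b b' hb hb' => hA.tag_inj b b' (hknown b hb) (hknown b' hb'), ?_, ?_⟩, hext, hself, ?_⟩
  · intro y u b' h
    obtain ⟨n, t', h1, h2, h3⟩ := hA.find y u b' h
    exact ⟨n, t', h1, h2, h3.ext hext⟩
  · intro k w h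
    by_cases hk : k = l.tag
    · subst hk
      exact_mod_cast hA.tag_lt l hl
    · rw [hlook k hk] at h
      exact hA.key_lt k w h
  · intro b w hb h
    by_cases hk : b.tag = l.tag
    · obtain rfl := hA.tag_inj b l (hknown b hb) hl hk
      obtain rfl := Option.some_injective _ (hself.symm.trans h)
      exact ⟨hv, hr.ext hext⟩
    · rw [hlook _ (by exact_mod_cast hk)] at h
      obtain ⟨h1, h2⟩ := hA.results b w (hknown b hb) h
      exact ⟨h1, h2.ext hext⟩
  · intro b hb hlt
    apply hlook
    intro hk
    obtain rfl := hA.tag_inj b l hb hl (by exact_mod_cast hk)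
    exact lt_irrefl _ hlt

theorem exists_runs_mqs_nil {A : Contents} {r : BList} {n : ℕ} (hA : A.Inv r)
    (hl : A.Known r (.nil n)) :
    ∃ v A', Runs (MqsRel (.nil n)) A v A' 16 ∧ A.Called r (.nil n) v A' := by
  cases hv : A.results.lookup (n : ℤ) with
  | some v =>
    obtain ⟨h1, h2⟩ := exists_runs_mqs_found (l := .nil n) hA hv
    exact ⟨v, A, h1.mono (by norm_num), h2⟩
  | none => exact ⟨[], _, runs_mqs_nil hv, hA.memoize (l := .nil n) hl hv rfl trivial⟩

/-- The cost of a call on a nonempty list in terms of the costs `K₁` and `K₂` of its recursive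
calls, whose arguments are the hash-consed boxes of the two filtered lists. -/
theorem exists_runs_mqs_cons {A : Contents} {r t : BList} {n : ℕ} {x : ℤ} (hA : A.Inv r)
    (hl : A.Known r (.cons n x t)) {K₁ K₂ : ℕ}
    (hs : ∀ A₁ s, A₁.Inv r → A.Ext A₁ → A₁.Canon s →
      s.toList = t.toList.filter (fun y => decide (y < x)) →
      ∃ v A₂, Runs (MqsRel s) A₁ v A₂ K₁ ∧ A₁.Called r s v A₂)
    (hg : ∀ A₁ g, A₁.Inv r → A.Ext A₁ → A₁.Canon g →
      g.toList = t.toList.filter (fun y => decide (y ≥ x)) →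
      ∃ v A₂, Runs (MqsRel g) A₁ v A₂ K₂ ∧ A₁.Called r g v A₂) :
    ∃ v A', Runs (MqsRel (.cons n x t)) A v A' (K₁ + K₂ + 90 * (t.toList.length + 1)) ∧
      A.Called r (.cons n x t) v A' := by
  cases hv : A.results.lookup (n : ℤ) with
  | some v =>
    obtain ⟨h1, h2⟩ := exists_runs_mqs_found (l := .cons n x t) hA hv
    exact ⟨v, A, h1.mono (by omega), h2⟩
  | none =>
    obtain ⟨s, A₁, r1, hA₁, e1, q1, hcs, hls⟩ :=
      exists_runs_mfil (fun y => decide (y < x)) t hA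
    obtain ⟨g, A₂, r2, hA₂, e2, q2, hcg, hlg⟩ :=
      exists_runs_mfil (fun y => decide (y ≥ x)) t hA₁
    obtain ⟨ss, A₃, r3, c3⟩ := hs A₂ s hA₂ (e1.trans e2) (hcs.ext e2) hls
    obtain ⟨gg, A₄, r4, c4⟩ := hg A₃ g c3.inv ((e1.trans e2).trans c3.ext) (hcg.ext c3.ext) hlg
    have e4 : A.Ext A₄ := ((e1.trans e2).trans c3.ext).trans c4.ext
    have lss := c3.length_eq (Or.inl (hcs.ext e2))
    have lgg := c4.length_eq (Or.inl (hcg.ext c3.ext))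
    have les : s.toList.length ≤ t.toList.length := hls ▸ List.length_filter_le _ _
    have leg : g.toList.length ≤ t.toList.length := hlg ▸ List.length_filter_le _ _
    -- The recursive calls do not touch the entries of lists longer than `t`.
    have hframe : ∀ b, A.Known r b → t.toList.length < b.toList.length →
        A₄.results.lookup (b.tag : ℤ) = A.results.lookup (b.tag : ℤ) := by
      intro b hb hlt
      rw [c4.frame b (hb.ext ((e1.trans e2).trans c3.ext)) (leg.trans_lt hlt),
        c3.frame b (hb.ext (e1.trans e2)) (les.trans_lt hlt), q2, q1]
    have hv' : A₄.results.lookup (n : ℤ) = none :=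
      (hframe _ hl (by simp [BList.toList])).trans hv
    have hsum : s.toList.length + g.toList.length = t.toList.length := by
      rw [hls, hlg, ← List.countP_eq_length_filter, ← List.countP_eq_length_filter,
        List.length_eq_countP_add_countP (fun y => decide (y < x))]
      congr 1
      refine List.countP_congr fun y _ => ?_
      simp
    have hready : A₄.Ready (BList.cons n x t).toList := by
      constructor
      · rw [← hls]; exact (c3.done (hcs.ext e2)).ext c4.ext
      · rw [← hlg]; exact c4.done (hcg.ext c3.ext)
    have hlen : (ss ++ x :: gg).length = (BList.cons n x t).toList.length := by
      simp only [List.length_append, List.length_cons, BList.toList]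
      omega
    have hc := c4.inv.memoize (l := .cons n x t) (hl.ext e4) hv' hlen hready
    -- The two filters cost `36 * (|t| + 1)` each, and appending costs `|ss| ≤ |t|` and a constant.
    refine ⟨_, _, (Runs.mqs_cons hv r1 r2 r3 r4 hv').mono ?_,
      hc.inv, e4.trans hc.ext, hc.result, ?_⟩
    · omega
    · intro b hb hlt
      refine (hc.frame b (hb.ext e4) hlt).trans (hframe b hb ?_)
      simp only [BList.toList, List.length_cons] at hlt
      omega

/-- Quicksort terminates.  The bound is crude: the cost of the first run does not matter. -/
theorem exists_runs_mqs {r : BList} (m : ℕ) :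
    ∀ {A : Contents} {l : BList}, A.Inv r → A.Known r l → l.toList.length ≤ m →
      ∃ v A', Runs (MqsRel l) A v A' (90 * 4 ^ m) ∧ A.Called r l v A' := by
  induction m with
  | zero =>
    intro A l hA hl hm
    cases l with
    | nil n =>
      obtain ⟨v, A', h1, h2⟩ := exists_runs_mqs_nil hA hl
      exact ⟨v, A', h1.mono (by norm_num), h2⟩
    | cons n x t => simp [BList.toList] at hm
  | succ m ih =>
    intro A l hA hl hm
    cases l with
    | nil n =>
      obtain ⟨v, A', h1, h2⟩ := exists_runs_mqs_nil hA hl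
      have := Nat.one_le_pow (m + 1) 4 (by norm_num)
      exact ⟨v, A', h1.mono (by omega), h2⟩
    | cons n x t =>
      simp only [BList.toList, List.length_cons] at hm
      have hle : ∀ (g : ℤ → Bool) (b : BList), b.toList = t.toList.filter g →
          b.toList.length ≤ m := by
        intro g b hb
        have := List.length_filter_le g t.toList
        rw [hb]; omega
      obtain ⟨v, A', h1, h2⟩ := exists_runs_mqs_cons hA hl
        (fun A₁ s h _ hc hs => ih h (Or.inl hc) (hle _ _ hs))
        (fun A₁ s h _ hc hs => ih h (Or.inl hc) (hle _ _ hs))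
      have : m < 4 ^ m := Nat.lt_pow_self (by norm_num)
      exact ⟨v, A', h1.mono (by rw [pow_succ]; omega), h2⟩

end Contents

/-! ### The search path of the new key -/

/-- Whether the pivot `x` leaves `y` on the side of `a`: if `x < a`, this is the side of the keys
that are at least `x`, and otherwise that of the keys less than `x`. -/
def sameSide (a x y : ℤ) : Bool := if x < a then decide (y ≥ x) else decide (y < x)

/-- The sum of the subtree sizes along the search path of `a`, in the search tree that Quicksort
builds from the keys of the list that satisfy `p`; a subtree with `m` keys counts `m + 1`.
The keys are read in order: those outside the current subtree of the search path are
skipped, and the others move on to a smaller subtree. -/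
def pathSize (a : ℤ) (p : ℤ → Bool) : List ℤ → ℕ
  | [] => 1
  | x :: L =>
    if p x then L.countP p + 2 + pathSize a (fun y => sameSide a x y && p y) L
    else pathSize a p L

namespace Contents

/-- If the recursive calls for the list of the keys with `p` are done, then Quicksort on the part
less than `a` recurs only along the search path of `a`: the argument of the other recursive call
is the box of a list that an earlier call has met, because equal hash-consed lists have one box. -/
theorem exists_runs_mqs_lt {r : BList} (a : ℤ) (L : List ℤ) :
    ∀ (p : ℤ → Bool) {A : Contents} {b : BList}, A.Inv r → A.Ready (L.filter p) → A.Canon b →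
      b.toList = (L.filter p).filter (fun y => decide (y < a)) →
      ∃ v A', Runs (MqsRel b) A v A' (90 * pathSize a p L) ∧ A.Called r b v A' := by
  induction L with
  | nil =>
    intro p A b hA _ hb hl
    cases b with
    | nil n =>
      obtain ⟨v, A', h1, h2⟩ := exists_runs_mqs_nil hA (Or.inl hb)
      exact ⟨v, A', h1.mono (by simp [pathSize]), h2⟩
    | cons n x t => simp [BList.toList] at hl
  | cons x L ih =>
    intro p A b hA hr hb hl
    cases hp : p x with
    | false =>
      rw [List.filter_cons_of_neg (by simp [hp])] at hr hl
      simpa [pathSize, hp] using ih p hA hr hb hl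
    | true =>
      rw [List.filter_cons_of_pos hp] at hr hl
      set p' : ℤ → Bool := fun y => sameSide a x y && p y with hp'
      have hsize : pathSize a p (x :: L) = L.countP p + 2 + pathSize a p' L := by
        simp [pathSize, hp, hp']
      rw [hsize]
      by_cases hxa : x < a
      · rw [List.filter_cons_of_pos (by simpa using hxa)] at hl
        have hK : (L.filter p).filter (fun y => decide (y ≥ x)) = L.filter p' := by
          rw [List.filter_filter]
          exact List.filter_congr fun y _ => by simp [hp', sameSide, hxa]
        cases b with
        | nil n => simp [BList.toList] at hl
        | cons n z t =>
          simp only [BList.toList, List.cons.injEq] at hl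
          obtain ⟨rfl, hl⟩ := hl
          have hlen : t.toList.length ≤ L.countP p := by
            rw [hl, List.countP_eq_length_filter]
            exact List.length_filter_le _ _
          obtain ⟨v, A', h1, h2⟩ := exists_runs_mqs_cons (K₁ := 3)
            (K₂ := 90 * pathSize a p' L) hA (Or.inl hb) (by
              intro A₁ s hA₁ hext hcs hs
              have hs' : s.toList = (L.filter p).filter (fun y => decide (y < z)) := by
                rw [hs, hl, List.filter_filter]
                exact List.filter_congr fun y _ => by
                  rw [Bool.eq_iff_iff]; simp; omega
              obtain ⟨v, hv⟩ := hcs.exists_result (hs' ▸ hr.1.ext hext)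
              exact ⟨v, A₁, exists_runs_mqs_found hA₁ hv⟩)
            (by
              intro A₁ g hA₁ hext hcg hg
              refine ih p' hA₁ (hK ▸ hA₁.ready_of_done (hr.2.ext hext)) hcg ?_
              rw [hg, hl, ← hK]
              simp only [List.filter_filter, Bool.and_left_comm])
          exact ⟨v, A', h1.mono (by omega), h2⟩
      · rw [List.filter_cons_of_neg (by simpa using hxa)] at hl
        have hK : (L.filter p).filter (fun y => decide (y < x)) = L.filter p' := by
          rw [List.filter_filter]
          exact List.filter_congr fun y _ => by simp [hp', sameSide, hxa]
        obtain ⟨v, A', h1, h2⟩ := ih p' hA (hK ▸ hA.ready_of_done hr.1) hb (by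
          rw [hl, ← hK, List.filter_filter (l := L.filter p)]
          exact List.filter_congr fun y _ => by
            rw [Bool.eq_iff_iff]; simp; omega)
        exact ⟨v, A', h1.mono (by omega), h2⟩

/-- The counterpart of `exists_runs_mqs_lt` for the part that is at least `a`. -/
theorem exists_runs_mqs_ge {r : BList} (a : ℤ) (L : List ℤ) :
    ∀ (p : ℤ → Bool) {A : Contents} {b : BList}, A.Inv r → A.Ready (L.filter p) → A.Canon b →
      b.toList = (L.filter p).filter (fun y => decide (y ≥ a)) →
      ∃ v A', Runs (MqsRel b) A v A' (90 * pathSize a p L) ∧ A.Called r b v A' := by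
  induction L with
  | nil =>
    intro p A b hA _ hb hl
    cases b with
    | nil n =>
      obtain ⟨v, A', h1, h2⟩ := exists_runs_mqs_nil hA (Or.inl hb)
      exact ⟨v, A', h1.mono (by simp [pathSize]), h2⟩
    | cons n x t => simp [BList.toList] at hl
  | cons x L ih =>
    intro p A b hA hr hb hl
    cases hp : p x with
    | false =>
      rw [List.filter_cons_of_neg (by simp [hp])] at hr hl
      simpa [pathSize, hp] using ih p hA hr hb hl
    | true =>
      rw [List.filter_cons_of_pos hp] at hr hl
      set p' : ℤ → Bool := fun y => sameSide a x y && p y with hp'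
      have hsize : pathSize a p (x :: L) = L.countP p + 2 + pathSize a p' L := by
        simp [pathSize, hp, hp']
      rw [hsize]
      by_cases hxa : x < a
      · rw [List.filter_cons_of_neg (by simpa using hxa)] at hl
        have hK : (L.filter p).filter (fun y => decide (y ≥ x)) = L.filter p' := by
          rw [List.filter_filter]
          exact List.filter_congr fun y _ => by simp [hp', sameSide, hxa]
        obtain ⟨v, A', h1, h2⟩ := ih p' hA (hK ▸ hA.ready_of_done hr.2) hb (by
          rw [hl, ← hK, List.filter_filter (l := L.filter p)]
          exact List.filter_congr fun y _ => by
            rw [Bool.eq_iff_iff]; simp; omega)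
        exact ⟨v, A', h1.mono (by omega), h2⟩
      · rw [List.filter_cons_of_pos (by simpa using hxa)] at hl
        have hK : (L.filter p).filter (fun y => decide (y < x)) = L.filter p' := by
          rw [List.filter_filter]
          exact List.filter_congr fun y _ => by simp [hp', sameSide, hxa]
        cases b with
        | nil n => simp [BList.toList] at hl
        | cons n z t =>
          simp only [BList.toList, List.cons.injEq] at hl
          obtain ⟨rfl, hl⟩ := hl
          have hlen : t.toList.length ≤ L.countP p := by
            rw [hl, List.countP_eq_length_filter]
            exact List.length_filter_le _ _
          obtain ⟨v, A', h1, h2⟩ := exists_runs_mqs_cons (K₁ := 90 * pathSize a p' L)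
            (K₂ := 3) hA (Or.inl hb) (by
              intro A₁ s hA₁ hext hcs hs
              refine ih p' hA₁ (hK ▸ hA₁.ready_of_done (hr.1.ext hext)) hcs ?_
              rw [hs, hl, ← hK]
              simp only [List.filter_filter, Bool.and_left_comm])
            (by
              intro A₁ g hA₁ hext hcg hg
              have hg' : g.toList = (L.filter p).filter (fun y => decide (y ≥ z)) := by
                rw [hg, hl, List.filter_filter]
                exact List.filter_congr fun y _ => by
                  rw [Bool.eq_iff_iff]; simp; omega
              obtain ⟨v, hv⟩ := hcg.exists_result (hg' ▸ hr.2.ext hext)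
              exact ⟨v, A₁, exists_runs_mqs_found hA₁ hv⟩)
          exact ⟨v, A', h1.mono (by omega), h2⟩

end Contents

/-- A bound for the second run: the probes to which collisions are charged do not depend on the
hash functions, and their number and the number of other steps are linear in the size of the
search path. -/
theorem exists_secondRunTime_le (shared : Bool) (a : ℤ) (L : List ℤ) :
    ∃ tr : List Probe, tr.length ≤ 90 * (L.length + 1) + 180 * pathSize a (fun _ => true) L ∧
      ∀ H, secondRunTime H shared a L ≤
        ((90 * (L.length + 1) + 180 * pathSize a (fun _ => true) L : ℕ) : ℝ≥0∞)
          + (excess H tr : ℝ≥0∞) := by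
  obtain ⟨l, A₀, K₀, h0, hA₀, hc₀, hl⟩ :=
    Contents.exists_runs_inputList Contents.inv_initial shared L
  obtain ⟨v, A₁, h1, c1⟩ := Contents.exists_runs_mqs _ hA₀ (Or.inr rfl) le_rfl
  obtain ⟨l', A₂, K₂, h2, hA₂, e2, -, hl'⟩ :=
    Contents.exists_runs_inputCons c1.inv shared a (fun h => (hc₀ h).ext c1.ext)
  have hready : A₂.Ready L := by
    have := (c1.inv.results l v (Or.inr rfl) c1.result).2
    rw [hl] at this
    exact this.ext e2
  have htrue : L.filter (fun _ => true) = L := List.filter_true L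
  cases l' with
  | nil n => simp [BList.toList] at hl'
  | cons n x t =>
    simp only [BList.toList, List.cons.injEq] at hl'
    obtain ⟨rfl, ht⟩ := hl'
    rw [hl] at ht
    obtain ⟨w, A₃, h3, -⟩ := Contents.exists_runs_mqs_cons hA₂ (Or.inr rfl)
      (K₁ := 90 * pathSize x (fun _ => true) L) (K₂ := 90 * pathSize x (fun _ => true) L)
      (fun A s hA hext hcs hs => Contents.exists_runs_mqs_lt x L _ hA
        (by rw [htrue]; exact hready.ext hext) hcs (by rw [htrue, ← ht]; exact hs))
      (fun A g hA hext hcg hg => Contents.exists_runs_mqs_ge x L _ hA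
        (by rw [htrue]; exact hready.ext hext) hcg (by rw [htrue, ← ht]; exact hg))
    rw [ht] at h3
    obtain ⟨tr, htr, h3⟩ := h3
    refine ⟨tr, by omega, fun H => ?_⟩
    obtain ⟨_, h0⟩ := h0
    obtain ⟨_, h1⟩ := h1
    obtain ⟨_, h2⟩ := h2
    obtain ⟨σ₀, r0, w0, q0, -⟩ := h0.2 H _ (Store.valid_initial H) rfl
    obtain ⟨σ₁, r1, w1, q1, -⟩ := h1.2 H σ₀ w0 q0
    obtain ⟨σ₂, r2, w2, q2, -⟩ := h2.2 H σ₁ w1 q1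
    obtain ⟨σ₃, r3, -, -, hclock⟩ := h3 H { σ₂ with clock := 0 } ⟨w2.results, w2.heads, w2.tails⟩ q2
    have hrun : SecondRun H shared x L σ₃.clock :=
      ⟨l, _, σ₀, σ₁, σ₂, σ₃, v, w, r0, r1, r2, r3, rfl⟩
    refine (iInf₂_le σ₃.clock hrun).trans ?_
    rw [← Nat.cast_add]
    refine Nat.cast_le.2 (hclock.trans ?_)
    simp only [zero_add]
    omega

/-! ### The average size of the search path -/

section Average

open Finset

/-- Ordered pairs with `v i < v k` are at most half of all pairs of different indices. -/
theorem two_mul_sum_card_lt {ι : Type*} [DecidableEq ι] (s : Finset ι) (v : ι → ℤ) :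
    2 * ∑ i ∈ s, #{k ∈ s | v i < v k} + #s ≤ #s ^ 2 := by
  have hswap : ∑ i ∈ s, #{k ∈ s | v i < v k} = ∑ i ∈ s, #{k ∈ s | v k < v i} :=
    sum_card_bipartiteAbove_eq_sum_card_bipartiteBelow fun i k => v i < v k
  calc 2 * ∑ i ∈ s, #{k ∈ s | v i < v k} + #s
      = ∑ i ∈ s, (#{k ∈ s | v i < v k} + #{k ∈ s | v k < v i} + #{k ∈ s | k = i}) := by
        have h1 : ∀ i ∈ s, #{k ∈ s | k = i} = 1 := fun i hi => by simp [filter_eq', hi]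
        rw [sum_add_distrib, sum_add_distrib, ← hswap, sum_congr rfl h1]
        simp
        ring
    _ ≤ ∑ _i ∈ s, #s := by
        refine sum_le_sum fun i _ => ?_
        rw [← card_union_of_disjoint, ← card_union_of_disjoint]
        · refine card_le_card ?_
          intro k
          simp only [mem_union, mem_filter]
          tauto
        · rw [disjoint_left]
          intro k
          simp only [mem_union, mem_filter]
          rintro (⟨_, h⟩ | ⟨_, h⟩) ⟨_, rfl⟩ <;> exact lt_irrefl _ h
        · rw [disjoint_left]
          intro k
          simp only [mem_filter]
          rintro ⟨_, h⟩ ⟨_, h'⟩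
          exact lt_asymm h h'
    _ = #s ^ 2 := by simp [sq]

/-- A random pivot leaves on the side of `a` at most three quarters of the keys on average. -/
theorem four_mul_sum_card_sameSide {ι : Type*} [DecidableEq ι] (s : Finset ι) {v : ι → ℤ}
    (hv : Function.Injective v) (a : ℤ) :
    4 * ∑ i ∈ s, #{k ∈ s | k ≠ i ∧ sameSide a (v i) (v k) = true} + #s ≤ 3 * #s ^ 2 := by
  set A := s.filter fun i => v i < a with hA
  set B := s.filter fun i => ¬ v i < a with hB
  have hcard : #A + #B = #s := card_filter_add_card_filter_not _
  have hle : ∀ i k, k ≠ i → v i ≤ v k → v i < v k := fun i k hk h =>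
    lt_of_le_of_ne h fun e => hk (hv e).symm
  have h1 : ∀ i ∈ A, #{k ∈ s | k ≠ i ∧ sameSide a (v i) (v k) = true} ≤
      #{k ∈ A | v i < v k} + #B := by
    intro i hi
    rw [hA, mem_filter] at hi
    refine (card_le_card ?_).trans (card_union_le _ _)
    intro k
    simp only [sameSide, hi.2, if_true, mem_union, mem_filter, hA, hB, decide_eq_true_eq]
    rintro ⟨hk, hki, h⟩
    have := hle i k hki h
    tauto
  have h2 : ∀ i ∈ B, #{k ∈ s | k ≠ i ∧ sameSide a (v i) (v k) = true} ≤
      #{k ∈ B | - v i < - v k} + #A := by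
    intro i hi
    rw [hB, mem_filter] at hi
    refine (card_le_card ?_).trans (card_union_le _ _)
    intro k
    simp only [sameSide, hi.2, if_false, mem_union, mem_filter, hA, hB, decide_eq_true_eq,
      neg_lt_neg_iff]
    tauto
  have h3 := two_mul_sum_card_lt A v
  have h4 := two_mul_sum_card_lt B fun i => - v i
  have h5 : ∑ i ∈ s, #{k ∈ s | k ≠ i ∧ sameSide a (v i) (v k) = true} ≤
      (∑ i ∈ A, #{k ∈ A | v i < v k} + #A * #B) +
        (∑ i ∈ B, #{k ∈ B | - v i < - v k} + #B * #A) := by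
    rw [← sum_filter_add_sum_filter_not s fun i => v i < a]
    refine add_le_add ((sum_le_sum h1).trans ?_) ((sum_le_sum h2).trans ?_) <;>
      rw [sum_add_distrib, sum_const, smul_eq_mul]
  rw [← hcard]
  zify at h3 h4 h5 ⊢
  nlinarith [sq_nonneg ((#A : ℤ) - #B)]

theorem countP_ofFn_comp_perm {n : ℕ} (w : Fin n → ℤ) (π : Equiv.Perm (Fin n)) (p : ℤ → Bool) :
    (List.ofFn fun j => w (π j)).countP p = #{j | p (w j) = true} := by
  have h := (Equiv.Perm.ofFn_comp_perm π w).countP_eq p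
  rw [show (List.ofFn fun j => w (π j)) = List.ofFn (w ∘ π) from rfl, h, List.ofFn_eq_map,
    List.countP_map, List.countP_eq_length_filter, Finset.card_def, Finset.filter_val,
    Fin.univ_def]
  change _ = Multiset.card (Multiset.filter _ (List.finRange n : Multiset (Fin n)))
  rw [Multiset.filter_coe, Multiset.coe_card]
  simp [Function.comp_def]

/-- The average over all orders of `n` keys of the size of the search path of `a`, restricted to
the keys with `p`, is linear in the number of these keys.  By induction on `n`, according to the
first key: a key without `p` is skipped, and among the keys with `p` the first is uniformly
distributed. -/
theorem sum_pathSize_le (a : ℤ) (n : ℕ) :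
    ∀ (v : Fin n → ℤ), Function.Injective v → ∀ p : ℤ → Bool,
      ∑ π : Equiv.Perm (Fin n), pathSize a p (List.ofFn fun i => v (π i)) ≤
        n.factorial * (4 * #{i | p (v i) = true} + 1) := by
  induction n with
  | zero => intro v _ p; simp [pathSize]
  | succ n ih =>
    intro v hv p
    set s : Finset (Fin (n + 1)) := {i | p (v i) = true} with hs
    -- The keys that remain after the first key `v i`.
    let τ : Fin (n + 1) → Fin n → Fin (n + 1) := fun i j => Equiv.swap 0 i j.succ
    have hτ : ∀ i, Function.Injective (τ i) := fun i =>
      (Equiv.swap 0 i).injective.comp (Fin.succ_injective n)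
    have hcount : ∀ (i : Fin (n + 1)) (q : Fin (n + 1) → Prop) [DecidablePred q],
        #{j | q (τ i j)} = #{k | k ≠ i ∧ q k} := by
      intro i q _
      rw [← card_map ⟨τ i, hτ i⟩]
      congr 1
      ext k
      simp only [mem_map, mem_filter, mem_univ, true_and, Function.Embedding.coeFn_mk]
      constructor
      · rintro ⟨j, hj, rfl⟩
        refine ⟨fun h => ?_, hj⟩
        have := congrArg (Equiv.swap 0 i) h
        simp [τ] at this
      · rintro ⟨hk, hq⟩
        have h0 : Equiv.swap 0 i k ≠ 0 := by
          intro h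
          have := congrArg (Equiv.swap 0 i) h
          simp [hk] at this
        obtain ⟨j, hj⟩ := Fin.exists_succ_eq.2 h0
        have hjk : τ i j = k := by simp [τ, hj]
        exact ⟨j, hjk.symm ▸ hq, hjk⟩
    have hdecomp : ∑ π : Equiv.Perm (Fin (n + 1)), pathSize a p (List.ofFn fun i => v (π i)) =
        ∑ i, ∑ e : Equiv.Perm (Fin n),
          pathSize a p (v i :: List.ofFn fun j => v (τ i (e j))) := by
      rw [← Equiv.sum_comp Equiv.Perm.decomposeFin.symm, Fintype.sum_prod_type]
      simp [List.ofFn_succ, τ]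
    let m' : Fin (n + 1) → ℕ := fun i => #{k ∈ s | k ≠ i ∧ sameSide a (v i) (v k) = true}
    have hin : ∀ i ∈ s, ∑ e : Equiv.Perm (Fin n),
        pathSize a p (v i :: List.ofFn fun j => v (τ i (e j))) ≤
          n.factorial * (#s + 2 + 4 * m' i) := by
      intro i hi
      have hpi : p (v i) = true := by simpa [hs] using hi
      have hm : #{j | p (v (τ i j)) = true} + 1 = #s := by
        rw [hcount i fun k => p (v k) = true, ← card_erase_add_one hi]
        congr 2
        ext k
        simp [hs]
      have hm' : #{j | (sameSide a (v i) (v (τ i j)) && p (v (τ i j))) = true} = m' i := by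
        rw [hcount i fun k => (sameSide a (v i) (v k) && p (v k)) = true]
        congr 1
        ext k
        simp only [mem_filter, mem_univ, true_and, Bool.and_eq_true, hs]
        tauto
      simp only [pathSize, hpi, if_true]
      have hcp : ∀ e : Equiv.Perm (Fin n), (List.ofFn fun j => v (τ i (e j))).countP p + 2 =
          #s + 1 := fun e => by
        rw [countP_ofFn_comp_perm (fun j => v (τ i j)) e p]; omega
      simp only [hcp]
      have := ih (fun j => v (τ i j)) (hv.comp (hτ i)) fun y => sameSide a (v i) y && p y
      rw [hm'] at this
      rw [sum_add_distrib, sum_const, card_univ, Fintype.card_perm, Fintype.card_fin, smul_eq_mul]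
      refine (add_le_add_right this _).trans (le_of_eq ?_)
      ring
    have hout : ∀ i ∈ sᶜ, ∑ e : Equiv.Perm (Fin n),
        pathSize a p (v i :: List.ofFn fun j => v (τ i (e j))) ≤
          n.factorial * (4 * #s + 1) := by
      intro i hi
      have hpi : p (v i) = false := by simpa [hs] using hi
      have hm : #{j | p (v (τ i j)) = true} = #s := by
        rw [hcount i fun k => p (v k) = true, hs]
        congr 1
        ext k
        simp only [mem_filter, mem_univ, true_and, and_iff_right_iff_imp]
        rintro hk rfl
        simp [hpi] at hk
      simp only [pathSize, hpi, Bool.false_eq_true, if_false]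
      exact (ih (fun j => v (τ i j)) (hv.comp (hτ i)) p).trans_eq (by rw [hm])
    have hsum := four_mul_sum_card_sameSide s hv a
    have hcompl : #s + #sᶜ = n + 1 := by
      rw [card_add_card_compl, Fintype.card_fin]
    rw [hdecomp, ← sum_add_sum_compl s]
    calc _ ≤ ∑ i ∈ s, n.factorial * (#s + 2 + 4 * m' i) +
          ∑ _i ∈ sᶜ, n.factorial * (4 * #s + 1) := add_le_add (sum_le_sum hin) (sum_le_sum hout)
      _ = n.factorial * ((#s * (#s + 2) + 4 * ∑ i ∈ s, m' i) + #sᶜ * (4 * #s + 1)) := by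
          rw [← mul_sum, sum_add_distrib, sum_const, sum_const, smul_eq_mul, smul_eq_mul, ← mul_sum]
          ring
      _ ≤ n.factorial * ((n + 1) * (4 * #s + 1)) := by
          refine Nat.mul_le_mul_left _ ?_
          have hmul : (n + 1) * (4 * #s + 1) = (#s + #sᶜ) * (4 * #s + 1) := by rw [hcompl]
          rw [hmul]
          nlinarith
      _ = (n + 1).factorial * (4 * #s + 1) := by
          rw [Nat.factorial_succ]; ring

end Average

/-! ### Expected collisions -/

section Expectation

variable {Ω : Type*}

/-- The event that `y` is different from `k` and shares its bucket at level `j`. -/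
def collisionSet (H : Ω → Hashes) (i : TableId) (j : ℕ) (k y : ℤ) : Set Ω :=
  {ω | y ≠ k ∧ H ω i j y = H ω i j k}

theorem Probe.excess_eq_sum (H : Ω → Hashes) (p : Probe) (ω : Ω) :
    (p.excess (H ω) : ℝ≥0∞) = (p.keys.map fun y =>
      (collisionSet H p.table p.keys.length.size p.key y).indicator 1 ω).sum := by
  rw [Probe.excess, HashTable.collisions]
  generalize p.keys.length.size = j
  induction p.keys with
  | nil => simp
  | cons y keys ih =>
    rw [List.countP_cons, Nat.cast_add, ih, List.map_cons, List.sum_cons, add_comm]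
    congr 1
    by_cases hω : y ≠ p.key ∧ H ω p.table j y = H ω p.table j p.key
    · rw [Set.indicator_of_mem (show ω ∈ collisionSet H p.table j p.key y from hω)]
      simp [hω]
    · rw [Set.indicator_of_notMem (show ω ∉ collisionSet H p.table j p.key y from hω)]
      simp only [decide_eq_true_eq, if_neg hω, Nat.cast_zero]

variable [MeasurableSpace Ω] {P : Measure Ω} {c : ℝ≥0} {H : Ω → Hashes}

theorem IsUniversal.measurableSet_collisionSet (hH : IsUniversal P c H) (i : TableId) (j : ℕ)
    (k y : ℤ) : MeasurableSet (collisionSet H i j k y) := by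
  by_cases hy : y = k
  · simp [collisionSet, hy]
  · simpa [collisionSet, hy] using measurableSet_eq_fun (hH.measurable i j y) (hH.measurable i j k)

theorem IsUniversal.measure_collisionSet_le (hH : IsUniversal P c H) (i : TableId) (j : ℕ)
    (k y : ℤ) : P (collisionSet H i j k y) ≤ (c : ℝ≥0∞) / 2 ^ j := by
  by_cases hy : y = k
  · simp [collisionSet, hy]
  · simpa [collisionSet, hy] using hH.collision i j y k hy

theorem IsUniversal.measurable_excess (hH : IsUniversal P c H) (p : Probe) :
    Measurable fun ω => (p.excess (H ω) : ℝ≥0∞) := by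
  simp only [Probe.excess_eq_sum]
  generalize p.keys.length.size = j
  induction p.keys with
  | nil => simp
  | cons y keys ih =>
    simp only [List.map_cons, List.sum_cons]
    exact (measurable_one.indicator (hH.measurableSet_collisionSet _ _ _ _)).add ih

/-- A table has at least as many buckets as entries, so the expected number of collisions met by
a lookup is at most `c`. -/
theorem IsUniversal.lintegral_probe_le (hH : IsUniversal P c H) (p : Probe) :
    ∫⁻ ω, (p.excess (H ω) : ℝ≥0∞) ∂P ≤ c := by
  have hsum : ∀ (j : ℕ) (keys : List ℤ), ∫⁻ ω, (keys.map fun y =>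
      (collisionSet H p.table j p.key y).indicator (1 : Ω → ℝ≥0∞) ω).sum ∂P ≤
        keys.length * ((c : ℝ≥0∞) / 2 ^ j) := by
    intro j keys
    induction keys with
    | nil => simp
    | cons y keys ih =>
      have hmeas := hH.measurableSet_collisionSet p.table j p.key y
      simp only [List.map_cons, List.sum_cons]
      rw [lintegral_add_left (measurable_one.indicator hmeas), lintegral_indicator_one hmeas,
        List.length_cons, Nat.cast_add, Nat.cast_one, add_mul, one_mul, add_comm]
      exact add_le_add ih (hH.measure_collisionSet_le _ _ _ _)
  have hle : (p.keys.length : ℝ≥0∞) ≤ 2 ^ p.keys.length.size := by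
    exact_mod_cast (Nat.lt_size_self _).le
  simp only [Probe.excess_eq_sum]
  exact (hsum _ _).trans ((mul_le_mul_left hle _).trans ENNReal.mul_div_le)

theorem IsUniversal.lintegral_excess_le (hH : IsUniversal P c H) (tr : List Probe) :
    ∫⁻ ω, (excess (H ω) tr : ℝ≥0∞) ∂P ≤ tr.length * c := by
  induction tr with
  | nil => simp
  | cons p tr ih =>
    have hsplit : ∀ ω, (excess (H ω) (p :: tr) : ℝ≥0∞) =
        (p.excess (H ω) : ℝ≥0∞) + (excess (H ω) tr : ℝ≥0∞) := by
      intro ω; simp [excess]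
    simp only [hsplit]
    rw [lintegral_add_left (hH.measurable_excess p), List.length_cons, Nat.cast_add,
      Nat.cast_one, add_mul, one_mul, add_comm]
    exact add_le_add ih (hH.lintegral_probe_le p)

theorem IsUniversal.lintegral_secondRunTime_le [IsProbabilityMeasure P] (hH : IsUniversal P c H)
    (shared : Bool) (a : ℤ) (L : List ℤ) :
    ∫⁻ ω, secondRunTime (H ω) shared a L ∂P ≤
      ((90 * (L.length + 1) + 180 * pathSize a (fun _ => true) L : ℕ) : ℝ≥0∞) * (1 + c) := by
  obtain ⟨tr, htr, h⟩ := exists_secondRunTime_le shared a L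
  generalize 90 * (L.length + 1) + 180 * pathSize a (fun _ => true) L = K at htr h ⊢
  refine (lintegral_mono fun ω => h (H ω)).trans ?_
  rw [lintegral_add_left measurable_const, lintegral_const, measure_univ, mul_one, mul_add, mul_one]
  refine add_le_add le_rfl ((hH.lintegral_excess_le tr).trans ?_)
  exact mul_le_mul_left (Nat.cast_le.2 htr) _

/-- The total cost of the two parts is `90 (n + 1) + 180 s` for a search path of size `s`; on
average `s` is at most `4 n + 1`. -/
theorem IsUniversal.expectedTime_le [IsProbabilityMeasure P] (hH : IsUniversal P c H)
    (shared : Bool) {a : ℤ} {L : List ℤ} (hL : L.Nodup) :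
    expectedTime P H shared a L ≤ ((810 * (1 + c) : ℝ≥0) : ℝ≥0∞) * ((a :: L).length : ℝ≥0∞) := by
  have hinj : Function.Injective L.get := List.nodup_iff_injective_get.1 hL
  have hlen : ∀ π, (permuted L π).length = L.length := fun π => by simp [permuted]
  have hsum := sum_pathSize_le a L.length L.get hinj fun _ => true
  simp only [Finset.filter_true, Finset.card_univ, Fintype.card_fin] at hsum
  have hnat : ∑ π : Equiv.Perm (Fin L.length),
      (90 * (L.length + 1) + 180 * pathSize a (fun _ => true) (permuted L π)) ≤
        L.length.factorial * (810 * (L.length + 1)) := by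
    have h1 : ∑ π : Equiv.Perm (Fin L.length), 180 * pathSize a (fun _ => true) (permuted L π) =
        180 * ∑ π : Equiv.Perm (Fin L.length), pathSize a (fun _ => true) (permuted L π) :=
      (Finset.mul_sum _ _ _).symm
    rw [Finset.sum_add_distrib, h1, Finset.sum_const, Finset.card_univ,
      Fintype.card_perm, Fintype.card_fin, smul_eq_mul]
    refine (add_le_add le_rfl (Nat.mul_le_mul_left 180 hsum)).trans ?_
    generalize L.length.factorial = f
    nlinarith
  have hfac : (L.length.factorial : ℝ≥0∞) ≠ 0 := by exact_mod_cast L.length.factorial_ne_zero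
  refine ENNReal.div_le_of_le_mul' ?_
  calc ∑ π, ∫⁻ ω, secondRunTime (H ω) shared a (permuted L π) ∂P
      ≤ ∑ π : Equiv.Perm (Fin L.length), ((90 * (L.length + 1) +
          180 * pathSize a (fun _ => true) (permuted L π) : ℕ) : ℝ≥0∞) * (1 + c) := by
        refine Finset.sum_le_sum fun π _ => ?_
        have := hH.lintegral_secondRunTime_le shared a (permuted L π)
        rwa [hlen] at this
    _ = ((∑ π : Equiv.Perm (Fin L.length), (90 * (L.length + 1) +
          180 * pathSize a (fun _ => true) (permuted L π)) : ℕ) : ℝ≥0∞) * (1 + c) := by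
        rw [← Finset.sum_mul, Nat.cast_sum]
    _ ≤ ((L.length.factorial * (810 * (L.length + 1)) : ℕ) : ℝ≥0∞) * (1 + c) := by
        gcongr
    _ = _ := by
        push_cast [List.length_cons]
        ring

end Expectation

end MemoQuicksort

theorem mainTheorem2 (c : ℝ≥0) :
    ∃ C : ℝ≥0, ∀ (Ω : Type*) [MeasurableSpace Ω] (P : Measure Ω) [IsProbabilityMeasure P]
      (H : Ω → MemoQuicksort.Hashes), MemoQuicksort.IsUniversal P c H →
      ∀ (shared : Bool) (a : ℤ) (L : List ℤ), (a :: L).Nodup →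
        MemoQuicksort.expectedTime P H shared a L
          ≤ (C : ℝ≥0∞) * ((a :: L).length : ℝ≥0∞) := by
  exact ⟨810 * (1 + c), fun _ _ _ _ _ hH shared _ _ hL => hH.expectedTime_le shared hL.of_cons⟩
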